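/- Let $G=\mathrm{ASL}(2,\mathbb R)=\mathrm{SL}(2,\mathbb R)\ltimes\mathbb R^2$ with multiplication $(M,\xi)(M',\xi')=(MM',\xi M'+\xi')$, acting on row vectors from the right by $x\mapsto xM+\xi$. Let $\Gamma_{2,0}(4)$ be the group of all $M\in\mathrm{SL}(2,\mathbb Z)$ with $M\equiv\begin{pmatrix}1&0\\0&1\end{pmatrix}$ or $M\equiv\begin{pmatrix}1&2\\0&1\end{pmatrix}$ modulo $4$, let $\Lambda=\Gamma_{2,0}(4)\ltimes\mathbb Z^2$, $Y=\Lambda\backslash G$, and let $\mathbb H_-=\mathbb R_{\le 0}\times\mathbb R$, $\mathbb H_+=\mathbb R_{\ge 0}\times\mathbb R$. There is a $G$-invariant probability measure on $Y$. Let $\mu$ be such a measure, let $\Lambda g\in Y$ be random with distribution $\mu$, and consider the random point set $$\Theta=\big(\mathbb Z^2 g\cap\mathbb H_+\big)\cup\big(-\big(\big[\mathbb Z^2+(\tfrac12,-\tfrac14)\big]g\big)\cap\mathbb H_-\big),$$ which depends only on $\Lambda g$. Then for every real- or complex-valued $f\in L^1(\mathbb R^2\times\mathbb R^2)$ the sum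 $\sum_{y_1\ne y_2\in\Theta}f(y_1,y_2)$ over ordered pairs of distinct points of $\Theta$ converges absolutely almost surely, it is an integrable random variable, and $$\mathbb E\sum_{y_1\ne y_2\in\Theta}f(y_1,y_2)=\int_{\mathbb R^2\times\mathbb R^2}f(x_1,x_2)\,dx_1\,dx_2 .$$ -/

import Mathlib

open MeasureTheory
open scoped Matrix MatrixGroups

noncomputable section

/-- The Euclidean plane; its elements are row vectors. -/
abbrev Plane : Type := Fin 2 → ℝ

/-- The group `ASL(2,ℝ) = SL(2,ℝ) ⋉ ℝ²` of pairs `(M, ξ)`. -/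
@[ext]
structure ASL where
  lin : SL(2, ℝ)
  trans : Plane

namespace ASL

/-- The right action `x ↦ x M + ξ` of `(M, ξ)` on the plane. -/
def act (x : Plane) (g : ASL) : Plane := x ᵥ* (g.lin : Matrix (Fin 2) (Fin 2) ℝ) + g.trans

/-- `(M, ξ) (M', ξ') = (M M', ξ M' + ξ')`. -/
instance : Mul ASL := ⟨fun g h => ⟨g.lin * h.lin, act g.trans h⟩⟩

instance : One ASL := ⟨⟨1, 0⟩⟩

instance : Inv ASL :=
  ⟨fun g => ⟨g.lin⁻¹, -(g.trans ᵥ* ((g.lin⁻¹ : SL(2, ℝ)) : Matrix (Fin 2) (Fin 2) ℝ))⟩⟩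

theorem mul_lin (g h : ASL) : (g * h).lin = g.lin * h.lin := rfl

theorem mul_trans (g h : ASL) : (g * h).trans = act g.trans h := rfl

theorem act_mul (x : Plane) (g h : ASL) : act x (g * h) = act (act x g) h := by
  simp only [act, mul_lin, mul_trans, Matrix.SpecialLinearGroup.coe_mul, Matrix.add_vecMul,
    Matrix.vecMul_vecMul, add_assoc]

instance : Group ASL :=
  Group.ofLeftAxioms
    (fun a b c => by
      ext1
      · simp only [mul_lin, mul_assoc]
      · simp only [mul_trans, act_mul])
    (fun a => by
      ext1
      · change (1 : SL(2, ℝ)) * a.lin = a.lin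
        exact one_mul _
      · change (0 : Plane) ᵥ* (a.lin : Matrix (Fin 2) (Fin 2) ℝ) + a.trans = a.trans
        simp)
    (fun a => by
      ext1
      · change a.lin⁻¹ * a.lin = 1
        exact inv_mul_cancel _
      · change (-(a.trans ᵥ* ((a.lin⁻¹ : SL(2, ℝ)) : Matrix (Fin 2) (Fin 2) ℝ))) ᵥ*
            (a.lin : Matrix (Fin 2) (Fin 2) ℝ) + a.trans = 0
        rw [Matrix.neg_vecMul, Matrix.vecMul_vecMul, ← Matrix.SpecialLinearGroup.coe_mul,
          inv_mul_cancel]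
        simp)

/-- The topology of `SL(2,ℝ) × ℝ²`. -/
instance : TopologicalSpace ASL :=
  TopologicalSpace.induced (fun g : ASL => (g.lin, g.trans)) inferInstance

instance : MeasurableSpace ASL := borel ASL

instance : BorelSpace ASL := ⟨rfl⟩

end ASL

/-- The congruence subgroup of all `M ∈ SL(2,ℤ)` with
`M ≡ (1 0; 0 1)` or `M ≡ (1 2; 0 1)` modulo `4`. -/
def Gamma204 : Subgroup SL(2, ℤ) where
  carrier := {M | (M : Matrix (Fin 2) (Fin 2) ℤ).map (Int.cast : ℤ → ZMod 4) = !![1, 0; 0, 1] ∨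
    (M : Matrix (Fin 2) (Fin 2) ℤ).map (Int.cast : ℤ → ZMod 4) = !![1, 2; 0, 1]}
  one_mem' := by
    left
    ext i j
    fin_cases i <;> fin_cases j <;> simp
  mul_mem' := by
    intro A B hA hB
    have h : ((A * B : SL(2, ℤ)) : Matrix (Fin 2) (Fin 2) ℤ).map (Int.cast : ℤ → ZMod 4) =
        (A : Matrix (Fin 2) (Fin 2) ℤ).map (Int.cast : ℤ → ZMod 4) *
        (B : Matrix (Fin 2) (Fin 2) ℤ).map (Int.cast : ℤ → ZMod 4) := by
      rw [Matrix.SpecialLinearGroup.coe_mul]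
      exact Matrix.map_mul (f := Int.castRingHom (ZMod 4))
    simp only [Set.mem_ofPred_eq] at hA hB ⊢
    rw [h]
    rcases hA with hA | hA <;> rcases hB with hB | hB <;> rw [hA, hB] <;> decide
  inv_mem' := by
    intro A hA
    have h : ((A⁻¹ : SL(2, ℤ)) : Matrix (Fin 2) (Fin 2) ℤ).map (Int.cast : ℤ → ZMod 4) =
        ((A : Matrix (Fin 2) (Fin 2) ℤ).map (Int.cast : ℤ → ZMod 4)).adjugate := by
      rw [Matrix.SpecialLinearGroup.coe_inv]
      exact (Int.castRingHom (ZMod 4)).map_adjugate (A : Matrix (Fin 2) (Fin 2) ℤ)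
    simp only [Set.mem_ofPred_eq] at hA ⊢
    rw [h]
    rcases hA with hA | hA <;> rw [hA, Matrix.adjugate_fin_two] <;> decide

/-- An integer vector as a point of the plane. -/
def intVec (m : Fin 2 → ℤ) : Plane := fun i => (m i : ℝ)

/-- The embedding `(M, n) ↦ (M, n)` of integral matrices and vectors into `ASL(2,ℝ)`. -/
def intASL (M : SL(2, ℤ)) (n : Fin 2 → ℤ) : ASL := ⟨(M : SL(2, ℝ)), intVec n⟩

theorem intVec_act (m : Fin 2 → ℤ) (M : SL(2, ℤ)) (n : Fin 2 → ℤ) :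
    ASL.act (intVec m) (intASL M n) = intVec (m ᵥ* (M : Matrix (Fin 2) (Fin 2) ℤ) + n) := by
  ext i
  simp [ASL.act, intASL, intVec, Matrix.vecMul, dotProduct, Fin.sum_univ_two]

theorem intASL_mul (M N : SL(2, ℤ)) (m n : Fin 2 → ℤ) :
    intASL M m * intASL N n = intASL (M * N) (m ᵥ* (N : Matrix (Fin 2) (Fin 2) ℤ) + n) := by
  ext1
  · simp [ASL.mul_lin, intASL]
  · rw [ASL.mul_trans]
    exact intVec_act m N n

theorem intASL_one : intASL 1 0 = 1 := by
  ext1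
  · simp only [intASL, map_one]
    rfl
  · ext i
    change ((0 : ℤ) : ℝ) = 0
    simp

/-- The subgroup `Λ = Γ_{2,0}(4) ⋉ ℤ²` of `ASL(2,ℝ)`. -/
def Lam : Subgroup ASL where
  carrier := {g | ∃ M ∈ Gamma204, ∃ n : Fin 2 → ℤ, g = intASL M n}
  one_mem' := ⟨1, Gamma204.one_mem, 0, intASL_one.symm⟩
  mul_mem' := by
    rintro _ _ ⟨M, hM, m, rfl⟩ ⟨N, hN, n, rfl⟩
    exact ⟨M * N, Gamma204.mul_mem hM hN, _, intASL_mul M N m n⟩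
  inv_mem' := by
    rintro _ ⟨M, hM, m, rfl⟩
    refine ⟨M⁻¹, Gamma204.inv_mem hM,
      -(m ᵥ* ((M⁻¹ : SL(2, ℤ)) : Matrix (Fin 2) (Fin 2) ℤ)), ?_⟩
    rw [inv_eq_iff_mul_eq_one, intASL_mul, mul_inv_cancel, add_neg_cancel, intASL_one]

/-- The homogeneous space `Y = Λ \ ASL(2,ℝ)` of cosets `Λ g`. Its measurable structure is the
quotient one: a set is measurable iff its preimage in `ASL(2,ℝ)` is Borel. Since `Λ` is countable
and discrete, this is the Borel structure of the quotient topology. -/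
abbrev YSpace : Type := Quotient (QuotientGroup.rightRel Lam)

/-- Right translation `Λ g ↦ Λ g h` on `Y`. -/
def rightTranslate (h : ASL) : YSpace → YSpace :=
  Quotient.map (fun g => g * h) (by
    intro a b hab
    change QuotientGroup.rightRel Lam a b at hab
    change QuotientGroup.rightRel Lam (a * h) (b * h)
    rw [QuotientGroup.rightRel_apply] at hab ⊢
    simpa [mul_assoc] using hab)

/-- `μ` is an `ASL(2,ℝ)`-invariant probability measure on `Y`. -/
structure IsInvariantProbability (μ : Measure YSpace) : Prop where
  isProbabilityMeasure : IsProbabilityMeasure μ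
  invariant : ∀ h : ASL, MeasurePreserving (rightTranslate h) μ μ

/-- The left half plane `ℝ_{≤ 0} × ℝ`. -/
def leftHalfPlane : Set Plane := {x | x 0 ≤ 0}

/-- The right half plane `ℝ_{≥ 0} × ℝ`. -/
def rightHalfPlane : Set Plane := {x | 0 ≤ x 0}

/-- The affine lattice `(ℤ² + v) g`. -/
def affineLattice (v : Plane) (g : ASL) : Set Plane :=
  Set.range fun m : Fin 2 → ℤ => ASL.act (intVec m + v) g

/-- The vector `(1/2, -1/4)`. -/
def shiftVec : Plane := ![1 / 2, -1 / 4]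

/-- The point set `(ℤ² g ∩ ℍ₊) ∪ (-([ℤ² + (1/2, -1/4)] g) ∩ ℍ₋)`, for `g ∈ ASL(2,ℝ)`. -/
def thetaSet (g : ASL) : Set Plane :=
  (affineLattice 0 g ∩ rightHalfPlane) ∪
    ((fun x : Plane => -x) '' affineLattice shiftVec g ∩ leftHalfPlane)

/-- Every `γ ∈ Λ` maps `ℤ² + v` into itself for `v = 0` and for `v = (1/2, -1/4)`. -/
theorem exists_act_eq {γ : ASL} (hγ : γ ∈ Lam) {v : Plane} (hv : v = 0 ∨ v = shiftVec)
    (m : Fin 2 → ℤ) : ∃ n : Fin 2 → ℤ, ASL.act (intVec m + v) γ = intVec n + v := by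
  obtain ⟨M, hM, k, rfl⟩ := hγ
  rcases hv with rfl | rfl
  · exact ⟨m ᵥ* (M : Matrix (Fin 2) (Fin 2) ℤ) + k, by simpa using intVec_act m M k⟩
  · have key : (4 : ℤ) ∣ M 0 0 - 1 ∧ (2 : ℤ) ∣ M 0 1 ∧ (4 : ℤ) ∣ M 1 0 ∧ (4 : ℤ) ∣ M 1 1 - 1 := by
      have h4 : ∀ a b : ℤ, ((a : ℤ) : ZMod 4) = ((b : ℤ) : ZMod 4) → (4 : ℤ) ∣ a - b := by
        intro a b hab
        have := (ZMod.intCast_eq_intCast_iff_dvd_sub b a 4).1 hab.symm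
        simpa using this
      rcases hM with hM | hM
      all_goals
        have h00 := congrFun (congrFun hM 0) 0
        have h01 := congrFun (congrFun hM 0) 1
        have h10 := congrFun (congrFun hM 1) 0
        have h11 := congrFun (congrFun hM 1) 1
        simp at h00 h01 h10 h11
        have e00 := h4 (M 0 0) 1 (by simpa using h00)
        have e10 := h4 (M 1 0) 0 (by simpa using h10)
        have e11 := h4 (M 1 1) 1 (by simpa using h11)
      · have e01 := h4 (M 0 1) 0 (by simpa using h01)
        exact ⟨e00, by omega, by omega, e11⟩
      · have e01 := h4 (M 0 1) 2 (by simpa using h01)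
        exact ⟨e00, by omega, by omega, e11⟩
    obtain ⟨⟨a, ha⟩, ⟨b, hb⟩, ⟨c, hc⟩, ⟨d, hd⟩⟩ := key
    refine ⟨m ᵥ* (M : Matrix (Fin 2) (Fin 2) ℤ) + k + ![2 * a - c, b - d], ?_⟩
    have ha' : ((M 0 0 : ℤ) : ℝ) = 4 * a + 1 := by exact_mod_cast (by linarith : M 0 0 = 4 * a + 1)
    have hb' : ((M 0 1 : ℤ) : ℝ) = 2 * b := by exact_mod_cast hb
    have hc' : ((M 1 0 : ℤ) : ℝ) = 4 * c := by exact_mod_cast hc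
    have hd' : ((M 1 1 : ℤ) : ℝ) = 4 * d + 1 := by exact_mod_cast (by linarith : M 1 1 = 4 * d + 1)
    have hval : ∀ i : Fin 2, ASL.act (intVec m + shiftVec) (intASL M k) i =
        ((m 0 : ℝ) + 1 / 2) * ((M 0 i : ℤ) : ℝ) + ((m 1 : ℝ) + -1 / 4) * ((M 1 i : ℤ) : ℝ) +
          (k i : ℝ) := by
      intro i
      simp only [ASL.act, intASL, Pi.add_apply, Matrix.vecMul, dotProduct, Fin.sum_univ_two]
      rfl
    have hvec : ∀ i : Fin 2, (m ᵥ* (M : Matrix (Fin 2) (Fin 2) ℤ)) i =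
        m 0 * M 0 i + m 1 * M 1 i := by
      intro i
      simp only [Matrix.vecMul, dotProduct, Fin.sum_univ_two]
    have h0 : (((m ᵥ* (M : Matrix (Fin 2) (Fin 2) ℤ)) 0 + k 0 + (2 * a - c) : ℤ) : ℝ) + 1 / 2 =
        ASL.act (intVec m + shiftVec) (intASL M k) 0 := by
      rw [hval, hvec]
      push_cast
      rw [ha', hc']
      ring
    have h1 : (((m ᵥ* (M : Matrix (Fin 2) (Fin 2) ℤ)) 1 + k 1 + (b - d) : ℤ) : ℝ) + -1 / 4 =
        ASL.act (intVec m + shiftVec) (intASL M k) 1 := by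
      rw [hval, hvec]
      push_cast
      rw [hb', hd']
      ring
    ext i
    fin_cases i
    · exact h0.symm
    · exact h1.symm

theorem affineLattice_mul_subset {γ : ASL} (hγ : γ ∈ Lam) {v : Plane} (hv : v = 0 ∨ v = shiftVec)
    (g : ASL) : affineLattice v (γ * g) ⊆ affineLattice v g := by
  rintro _ ⟨m, rfl⟩
  obtain ⟨n, hn⟩ := exists_act_eq hγ hv m
  exact ⟨n, by simp only [ASL.act_mul, hn]⟩

theorem affineLattice_mul {γ : ASL} (hγ : γ ∈ Lam) {v : Plane} (hv : v = 0 ∨ v = shiftVec)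
    (g : ASL) : affineLattice v (γ * g) = affineLattice v g := by
  refine Set.Subset.antisymm (affineLattice_mul_subset hγ hv g) ?_
  simpa using affineLattice_mul_subset (Lam.inv_mem hγ) hv (γ * g)

/-- The random point set `Θ`, as a function of `Λ g ∈ Y`. -/
def Theta : YSpace → Set Plane :=
  Quotient.lift thetaSet (by
    intro a b hab
    change QuotientGroup.rightRel Lam a b at hab
    rw [QuotientGroup.rightRel_apply] at hab
    have h : b = (b * a⁻¹) * a := by simp
    rw [h]
    simp only [thetaSet, affineLattice_mul hab (Or.inl rfl), affineLattice_mul hab (Or.inr rfl)])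

/-- The sum of `f y₁ y₂` over the ordered pairs of distinct points `y₁ ≠ y₂` of `S`. -/
def pairSum {𝕜 : Type*} [RCLike 𝕜] (f : Plane × Plane → 𝕜) (S : Set Plane) : 𝕜 :=
  ∑' p : S.offDiag, f p

/-- The two-point intensity `K_f(Θ)`, the expected value of the sum of `f y₁ y₂` over `y₁ ≠ y₂ ∈ Θ`,
where `Θ = Θ(Λ g)` and `Λ g ∈ Y` has distribution `μ`. -/
def twoPointIntensity {𝕜 : Type*} [RCLike 𝕜] (μ : Measure YSpace) (f : Plane × Plane → 𝕜) : 𝕜 :=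
  ∫ y, pairSum f (Theta y) ∂μ

end

noncomputable section

open Filter
open scoped ENNReal Topology

/-! ### Coordinates and measurability on `ASL(2,ℝ)`. -/

namespace ASL

/-! A measurable section of the projection to `Y` lifts `μ` to a probability measure `P` on the
group. The lift keeps the invariance for integrals of left `Λ`-invariant functions
(`IsInvariantLift`). Sums over the points of `(ℤ² + v) g`, and over pairs of such points, are
functions of this kind, because `Λ` permutes `ℤ² + v` for both shifts `v`.

For shifts `v`, `w`, a pair of distinct points of `(ℤ² + v) g` and `(ℤ² + w) g` is a point `y`
together with a nonzero difference vector `z` in `(ℤ² + w - v) M`, with `M` the linear part of `g`.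
Averaging over translations spreads `y` uniformly, independently of the lattice
(`lintegral_tsum_translation`, `lintegral_mul_tsum_act`). Averaging over `SL(2,ℝ)` distributes `z`
with Lebesgue intensity (`lintegral_tsum_ne_zero`). So the pair intensity is Lebesgue measure
(`lintegral_tsum_pairs`).

Both averages follow one pattern. Invariance fixes the intensity up to a constant; for `z` this is
the uniqueness of the `SL(2,ℝ)`-invariant measure on the punctured plane
(`IsLinearInvariant.lintegral_mul_lintegral`). The constant is read off from large squares, where a
unimodular lattice translate has density one (`tendsto_tsum_square_div`). Dominated convergence
needs an integrable bound, the number of lattice vectors in `[-1, 1]²`. Its integrability comes from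
primitive vectors: a small square holds at most two of them, proportionality bounds their mean
number in any square by its area, and the sum over multiples converges like `∑ 1/d²`. No orbit
classification of `Γ` on the shifted lattice is needed.

For `Θ`, the half planes and the sign are absorbed into the test function. The four products of half
planes tile the space of pairs up to a null set, so the four contributions add up to the full
integral. Two labels can give the same point of `Θ` only on the vertical axis, which almost surely
contains no labelled point.

Existence of `μ` is independent of this: a Haar measure is built from Lebesgue measure on a cone of
matrices, and reduction theory shows that it has finite covolume. -/

theorem act_apply (x : Plane) (g : ASL) (i : Fin 2) :
    act x g i = x 0 * g.lin 0 i + x 1 * g.lin 1 i + g.trans i := by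
  simp only [act, Pi.add_apply, Matrix.vecMul, dotProduct, Fin.sum_univ_two]

/-- The matrix and the translation part of an element of `ASL(2,ℝ)`. -/
def coords (g : ASL) : (Fin 2 → Fin 2 → ℝ) × Plane := (fun i j => g.lin i j, g.trans)

theorem isInducing_coords : Topology.IsInducing coords := by
  have h1 : Topology.IsInducing (fun g : ASL => (g.lin, g.trans)) := ⟨rfl⟩
  have h2 : Topology.IsInducing (fun M : SL(2, ℝ) => (fun i j => M i j : Fin 2 → Fin 2 → ℝ)) :=
    Topology.IsInducing.subtypeVal
  exact (h2.prodMap Topology.IsInducing.id).comp h1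

instance : SecondCountableTopology ASL := isInducing_coords.secondCountableTopology

theorem exists_preimage_coords {s : Set ASL} (hs : MeasurableSet s) :
    ∃ t, MeasurableSet t ∧ coords ⁻¹' t = s := by
  have h : borel ASL = MeasurableSpace.comap coords (borel _) := by
    have := borel_comap (f := coords) (t := inferInstance)
    rwa [← isInducing_coords.eq_induced] at this
  have hs' : MeasurableSet[borel ASL] s := hs
  rw [h, ← BorelSpace.measurable_eq] at hs'
  exact hs'

theorem measurable_coords : Measurable coords := isInducing_coords.continuous.measurable

@[fun_prop]
theorem measurable_lin_apply (i j : Fin 2) : Measurable fun g : ASL => g.lin i j :=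
  (measurable_pi_apply j).comp ((measurable_pi_apply i).comp measurable_coords.fst)

@[fun_prop]
theorem measurable_trans : Measurable fun g : ASL => g.trans := measurable_coords.snd

@[fun_prop]
theorem measurable_trans_apply (i : Fin 2) : Measurable fun g : ASL => g.trans i :=
  (measurable_pi_apply i).comp measurable_trans

/-- The Borel sets of the group are pulled back from the matrix and translation entries, so
measurability can be tested entry by entry. -/
theorem measurable_of_coords {α : Type*} [MeasurableSpace α] {f : α → ASL}
    (h1 : ∀ i j, Measurable fun a => (f a).lin i j) (h2 : ∀ i, Measurable fun a => (f a).trans i) :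
    Measurable f := by
  have h : Measurable (coords ∘ f) :=
    (measurable_pi_lambda _ fun i => measurable_pi_lambda _ fun j => h1 i j).prodMk
      (measurable_pi_lambda _ h2)
  intro s hs
  obtain ⟨t, ht, rfl⟩ := exists_preimage_coords hs
  exact h ht

@[fun_prop]
theorem measurable_act (x : Plane) : Measurable fun g : ASL => act x g := by
  refine measurable_pi_lambda _ fun i => ?_
  simp only [act_apply]
  fun_prop

theorem measurable_act_right (g : ASL) : Measurable fun x : Plane => act x g := by
  refine measurable_pi_lambda _ fun i => ?_
  simp only [act_apply]
  fun_prop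

theorem mul_lin_apply (g h : ASL) (i j : Fin 2) :
    (g * h).lin i j = g.lin i 0 * h.lin 0 j + g.lin i 1 * h.lin 1 j := by
  rw [mul_lin, Matrix.SpecialLinearGroup.coe_mul, Matrix.mul_apply, Fin.sum_univ_two]

theorem measurable_mul_left (g : ASL) : Measurable fun h : ASL => g * h := by
  refine measurable_of_coords (fun i j => ?_) (fun i => ?_)
  · simp only [mul_lin_apply]
    fun_prop
  · simp only [mul_trans, act_apply]
    fun_prop

theorem measurable_mul_right (h : ASL) : Measurable fun g : ASL => g * h := by
  refine measurable_of_coords (fun i j => ?_) (fun i => ?_)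
  · simp only [mul_lin_apply]
    fun_prop
  · simp only [mul_trans, act_apply]
    fun_prop

theorem act_one (x : Plane) : act x 1 = x := by
  change x ᵥ* ((1 : SL(2, ℝ)) : Matrix (Fin 2) (Fin 2) ℝ) + 0 = x
  simp

theorem act_injective (g : ASL) : Function.Injective fun x => act x g := by
  intro x y h
  have : act (act x g) g⁻¹ = act (act y g) g⁻¹ := congrArg (fun z => act z g⁻¹) h
  simpa only [← act_mul, mul_inv_cancel, act_one] using this

/-- The translation `x ↦ x + ξ` as an element of `ASL(2,ℝ)`. -/
def translation (ξ : Plane) : ASL := ⟨1, ξ⟩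

/-- The linear map `x ↦ x M` as an element of `ASL(2,ℝ)`. -/
def linear (M : SL(2, ℝ)) : ASL := ⟨M, 0⟩

theorem act_translation (x ξ : Plane) : act x (translation ξ) = x + ξ := by
  simp [act, translation]

theorem act_linear (x : Plane) (M : SL(2, ℝ)) :
    act x (linear M) = x ᵥ* (M : Matrix (Fin 2) (Fin 2) ℝ) := by
  simp [act, linear]

theorem mul_translation_lin (g : ASL) (ξ : Plane) : (g * translation ξ).lin = g.lin :=
  mul_one g.lin

end ASL

theorem vecMul_apply_two (x : Plane) (M : SL(2, ℝ)) (i : Fin 2) :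
    (x ᵥ* (M : Matrix (Fin 2) (Fin 2) ℝ)) i = x 0 * M 0 i + x 1 * M 1 i := by
  simp only [Matrix.vecMul, dotProduct, Fin.sum_univ_two]

theorem measurable_vecMul (M : SL(2, ℝ)) :
    Measurable fun x : Plane => x ᵥ* (M : Matrix (Fin 2) (Fin 2) ℝ) := by
  simpa only [ASL.act_linear] using ASL.measurable_act_right (ASL.linear M)

@[fun_prop]
theorem measurable_vecMul_lin (x : Plane) :
    Measurable fun g : ASL => x ᵥ* (g.lin : Matrix (Fin 2) (Fin 2) ℝ) := by
  refine measurable_pi_lambda _ fun i => ?_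
  simp only [vecMul_apply_two]
  fun_prop

theorem det_eq_one (M : SL(2, ℝ)) : M 0 0 * M 1 1 - M 0 1 * M 1 0 = 1 := by
  rw [← Matrix.det_fin_two]
  exact M.2

/-- Unimodular linear maps preserve the area. -/
theorem measurePreserving_vecMul (M : SL(2, ℝ)) :
    MeasurePreserving (fun x : Plane => x ᵥ* (M : Matrix (Fin 2) (Fin 2) ℝ)) := by
  refine ⟨measurable_vecMul M, ?_⟩
  have h := Real.map_matrix_volume_pi_eq_smul_volume_pi
    (M := (M : Matrix (Fin 2) (Fin 2) ℝ)ᵀ) (by simp)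
  have e : (fun x : Plane => x ᵥ* (M : Matrix (Fin 2) (Fin 2) ℝ)) =
      Matrix.toLin' (M : Matrix (Fin 2) (Fin 2) ℝ)ᵀ := by
    funext x
    rw [Matrix.toLin'_apply, Matrix.mulVec_transpose]
  rw [e, h]
  simp

theorem measurePreserving_act (g : ASL) : MeasurePreserving fun x : Plane => ASL.act x g := by
  have := (measurePreserving_add_right (volume : Measure Plane) g.trans).comp
    (measurePreserving_vecMul g.lin)
  exact this

/-! ### The action of `Λ` on lattice translates. -/

instance : Countable SL(2, ℤ) := by
  have : Function.Injective fun M : SL(2, ℤ) => (fun i j => M i j : Fin 2 → Fin 2 → ℤ) :=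
    fun M N h => Subtype.ext h
  exact this.countable

instance : Countable Lam := by
  have : Function.Surjective (fun p : Gamma204 × (Fin 2 → ℤ) =>
      (⟨intASL p.1 p.2, ⟨p.1, p.1.2, p.2, rfl⟩⟩ : Lam)) := by
    rintro ⟨_, M, hM, n, rfl⟩
    exact ⟨(⟨M, hM⟩, n), rfl⟩
  exact this.countable

theorem intVec_injective : Function.Injective intVec := by
  intro m n h
  ext i
  have := congrFun h i
  simpa [intVec] using this

theorem intVec_add (m n : Fin 2 → ℤ) : intVec (m + n) = intVec m + intVec n := by
  ext i
  simp [intVec]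

theorem intVec_sub (m n : Fin 2 → ℤ) : intVec (m - n) = intVec m - intVec n := by
  ext i
  simp [intVec]

/-- The elements of `Λ` permute `ℤ² + v` for `v = 0` and for `v = (1/2, -1/4)`. -/
theorem exists_perm_act {γ : ASL} (hγ : γ ∈ Lam) {v : Plane} (hv : v = 0 ∨ v = shiftVec) :
    ∃ e : Equiv.Perm (Fin 2 → ℤ), ∀ m, ASL.act (intVec m + v) γ = intVec (e m) + v := by
  choose e he using exists_act_eq hγ hv
  choose e' he' using exists_act_eq (Lam.inv_mem hγ) hv
  have key : ∀ m n : Fin 2 → ℤ, intVec m + v = intVec n + v → m = n := fun m n h =>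
    intVec_injective (add_right_cancel h)
  refine ⟨⟨e, e', fun m => key _ _ ?_, fun m => key _ _ ?_⟩, he⟩
  · rw [← he', ← he, ← ASL.act_mul, mul_inv_cancel, ASL.act_one]
  · rw [← he, ← he', ← ASL.act_mul, inv_mul_cancel, ASL.act_one]

/-- The translate `ℤ² + c` is mapped onto itself by the linear parts of the elements of `Λ`. -/
def IsAdmissibleShift (c : Plane) : Prop :=
  ∀ γ ∈ Lam, ∃ e : Equiv.Perm (Fin 2 → ℤ), ∀ n,
    (intVec n + c) ᵥ* (γ.lin : Matrix (Fin 2) (Fin 2) ℝ) = intVec (e n) + c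

theorem ASL.act_sub_act (x y : Plane) (g : ASL) :
    act x g - act y g = (x - y) ᵥ* (g.lin : Matrix (Fin 2) (Fin 2) ℝ) := by
  simp [act, Matrix.sub_vecMul]

/-- Writing a vector as a difference of points of `ℤ² + w` and `ℤ² + v` cancels the translation part
of `γ`. The permutation is that of `ℤ² + w`, corrected by the image of the base point `0 + v`. -/
theorem isAdmissibleShift_sub {v w : Plane} (hv : v = 0 ∨ v = shiftVec)
    (hw : w = 0 ∨ w = shiftVec) : IsAdmissibleShift (w - v) := by
  intro γ hγ
  obtain ⟨e, he⟩ := exists_perm_act hγ hw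
  obtain ⟨e', he'⟩ := exists_perm_act hγ hv
  refine ⟨e.trans (Equiv.subRight (e' 0)), fun n => ?_⟩
  have h0 : intVec 0 = 0 := by
    ext i
    simp [intVec]
  have h : intVec n + (w - v) = (intVec n + w) - (intVec 0 + v) := by
    rw [h0]
    abel
  rw [h, ← ASL.act_sub_act, he, he', Equiv.trans_apply, Equiv.subRight_apply, intVec_sub]
  abel

/-! ### A Borel fundamental domain for `Λ` and a measurable section. -/

namespace ASL

theorem continuous_lin_apply (i j : Fin 2) : Continuous fun g : ASL => g.lin i j :=
  (continuous_apply_apply i j).comp isInducing_coords.continuous.fst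

theorem continuous_trans_apply (i : Fin 2) : Continuous fun g : ASL => g.trans i :=
  (continuous_apply i).comp isInducing_coords.continuous.snd

end ASL

theorem Int.eq_of_abs_cast_sub_lt_one {a b : ℤ} (h : |(a : ℝ) - b| < 1) : a = b := by
  have h' : |a - b| < 1 := by exact_mod_cast h
  have := Int.abs_lt_one_iff.1 h'
  omega

/-- `Λ` acts on `ASL(2,ℝ)` by left multiplication properly discontinuously and freely. -/
theorem exists_nhds_forall_mul_eq (g : ASL) : ∃ U : Set ASL, IsOpen U ∧ g ∈ U ∧
    ∀ a ∈ U, ∀ b ∈ U, ∀ γ ∈ Lam, γ * a = b → γ = 1 := by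
  -- For a pair `(a, b)` these are the entries of `B A⁻¹ - 1` and of `(b.trans - a.trans) A⁻¹`,
  -- where `A`, `B` are the linear parts. If `b = (M, n) a` they equal `M - 1` and `n`, so integers
  -- of absolute value below one must vanish.
  let φ : ASL × ASL → Fin 6 → ℝ := fun p =>
    ![p.2.lin 0 0 * p.1.lin 1 1 - p.2.lin 0 1 * p.1.lin 1 0 - 1,
      p.2.lin 0 1 * p.1.lin 0 0 - p.2.lin 0 0 * p.1.lin 0 1,
      p.2.lin 1 0 * p.1.lin 1 1 - p.2.lin 1 1 * p.1.lin 1 0,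
      p.2.lin 1 1 * p.1.lin 0 0 - p.2.lin 1 0 * p.1.lin 0 1 - 1,
      (p.2.trans 0 - p.1.trans 0) * p.1.lin 1 1 - (p.2.trans 1 - p.1.trans 1) * p.1.lin 1 0,
      (p.2.trans 1 - p.1.trans 1) * p.1.lin 0 0 - (p.2.trans 0 - p.1.trans 0) * p.1.lin 0 1]
  have hφ : Continuous φ := by
    have h1 : ∀ i j : Fin 2, Continuous fun p : ASL × ASL => p.1.lin i j := fun i j =>
      (ASL.continuous_lin_apply i j).comp continuous_fst
    have h2 : ∀ i j : Fin 2, Continuous fun p : ASL × ASL => p.2.lin i j := fun i j =>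
      (ASL.continuous_lin_apply i j).comp continuous_snd
    have h3 : ∀ i : Fin 2, Continuous fun p : ASL × ASL => p.1.trans i := fun i =>
      (ASL.continuous_trans_apply i).comp continuous_fst
    have h4 : ∀ i : Fin 2, Continuous fun p : ASL × ASL => p.2.trans i := fun i =>
      (ASL.continuous_trans_apply i).comp continuous_snd
    refine continuous_pi fun i => ?_
    fin_cases i
    · exact (((h2 0 0).mul (h1 1 1)).sub ((h2 0 1).mul (h1 1 0))).sub continuous_const
    · exact ((h2 0 1).mul (h1 0 0)).sub ((h2 0 0).mul (h1 0 1))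
    · exact ((h2 1 0).mul (h1 1 1)).sub ((h2 1 1).mul (h1 1 0))
    · exact (((h2 1 1).mul (h1 0 0)).sub ((h2 1 0).mul (h1 0 1))).sub continuous_const
    · exact (((h4 0).sub (h3 0)).mul (h1 1 1)).sub (((h4 1).sub (h3 1)).mul (h1 1 0))
    · exact (((h4 1).sub (h3 1)).mul (h1 0 0)).sub (((h4 0).sub (h3 0)).mul (h1 0 1))
  have hO : IsOpen (φ ⁻¹' Set.univ.pi fun _ => Metric.ball 0 1) :=
    (isOpen_set_pi Set.finite_univ fun _ _ => Metric.isOpen_ball).preimage hφ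
  have hg : (g, g) ∈ φ ⁻¹' Set.univ.pi fun _ => Metric.ball 0 1 := by
    have := det_eq_one g.lin
    intro i _
    rw [mem_ball_zero_iff]
    suffices φ (g, g) i = 0 by simp [this]
    fin_cases i
    · change g.lin 0 0 * g.lin 1 1 - g.lin 0 1 * g.lin 1 0 - 1 = 0
      linarith
    · change g.lin 0 1 * g.lin 0 0 - g.lin 0 0 * g.lin 0 1 = 0
      ring
    · change g.lin 1 0 * g.lin 1 1 - g.lin 1 1 * g.lin 1 0 = 0
      ring
    · change g.lin 1 1 * g.lin 0 0 - g.lin 1 0 * g.lin 0 1 - 1 = 0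
      linarith
    · change (g.trans 0 - g.trans 0) * g.lin 1 1 - (g.trans 1 - g.trans 1) * g.lin 1 0 = 0
      ring
    · change (g.trans 1 - g.trans 1) * g.lin 0 0 - (g.trans 0 - g.trans 0) * g.lin 0 1 = 0
      ring
  obtain ⟨U, V, hU, hV, hgU, hgV, hUV⟩ := isOpen_prod_iff.1 hO g g hg
  refine ⟨U ∩ V, hU.inter hV, ⟨hgU, hgV⟩, ?_⟩
  rintro a ⟨ha, -⟩ b ⟨-, hb⟩ _ ⟨M, hM, n, rfl⟩ rfl
  have key : ∀ i, |φ (a, intASL M n * a) i| < 1 := fun i => by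
    have := hUV (Set.mk_mem_prod ha hb) i trivial
    rwa [mem_ball_zero_iff] at this
  have hd := det_eq_one a.lin
  have hl : ∀ i j, (intASL M n * a).lin i j = M i 0 * a.lin 0 j + M i 1 * a.lin 1 j := fun i j => by
    rw [ASL.mul_lin_apply]
    rfl
  have ht : ∀ i, (intASL M n * a).trans i =
      n 0 * a.lin 0 i + n 1 * a.lin 1 i + a.trans i := fun i => by
    rw [ASL.mul_trans, ASL.act_apply]
    rfl
  have e0 : M 0 0 = 1 := Int.eq_of_abs_cast_sub_lt_one (by
    convert key 0 using 2
    simp only [φ, hl, Matrix.cons_val]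
    push_cast
    linear_combination (-(M 0 0 : ℝ)) * hd)
  have e1 : M 0 1 = 0 := Int.eq_of_abs_cast_sub_lt_one (by
    convert key 1 using 2
    simp only [φ, hl, Matrix.cons_val]
    push_cast
    linear_combination (-(M 0 1 : ℝ)) * hd)
  have e2 : M 1 0 = 0 := Int.eq_of_abs_cast_sub_lt_one (by
    convert key 2 using 2
    simp only [φ, hl, Matrix.cons_val]
    push_cast
    linear_combination (-(M 1 0 : ℝ)) * hd)
  have e3 : M 1 1 = 1 := Int.eq_of_abs_cast_sub_lt_one (by
    convert key 3 using 2
    simp only [φ, hl, Matrix.cons_val]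
    push_cast
    linear_combination (-(M 1 1 : ℝ)) * hd)
  have e4 : n 0 = 0 := Int.eq_of_abs_cast_sub_lt_one (by
    convert key 4 using 2
    simp only [φ, ht, Matrix.cons_val]
    push_cast
    linear_combination (-(n 0 : ℝ)) * hd)
  have e5 : n 1 = 0 := Int.eq_of_abs_cast_sub_lt_one (by
    convert key 5 using 2
    simp only [φ, ht, Matrix.cons_val]
    push_cast
    linear_combination (-(n 1 : ℝ)) * hd)
  have hM1 : M = 1 := by
    ext i j
    fin_cases i <;> fin_cases j <;> simp [e0, e1, e2, e3]
  have hn0 : n = 0 := by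
    ext i
    fin_cases i <;> simp [e4, e5]
  rw [hM1, hn0, intASL_one]

/-- There is a Borel set that contains exactly one element of every coset `Λ g`. -/
theorem exists_strict_fundamentalDomain :
    ∃ D : Set ASL, MeasurableSet D ∧ ∀ g : ASL, ∃! γ : Lam, (γ : ASL) * g ∈ D := by
  classical
  choose U hUo hgU hU using exists_nhds_forall_mul_eq
  obtain ⟨s, hs, hcov⟩ := TopologicalSpace.countable_cover_nhds fun g => (hUo g).mem_nhds (hgU g)
  have hne : s.Nonempty := by
    by_contra h
    rw [Set.not_nonempty_iff_eq_empty] at h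
    simp [h, Set.eq_univ_iff_forall] at hcov
  obtain ⟨a, rfl⟩ := hs.exists_eq_range hne
  have hmeet : ∀ g : ASL, ∃ n, ∃ γ : Lam, (γ : ASL) * g ∈ U (a n) := by
    intro g
    have : g ∈ ⋃ x ∈ Set.range a, U x := hcov ▸ Set.mem_univ g
    simp only [Set.mem_iUnion, Set.mem_range, exists_prop, exists_exists_eq_and] at this
    obtain ⟨n, hn⟩ := this
    exact ⟨n, 1, by simpa using hn⟩
  have hmul : ∀ γ : Lam, Measurable fun g : ASL => (γ : ASL) * g := fun γ =>
    ASL.measurable_mul_left _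
  -- From each coset keep its points in the first `U (a n)` that it meets. The coset meets that
  -- neighbourhood only once.
  refine ⟨⋃ n, U (a n) \ ⋃ k : Fin n, ⋃ γ : Lam, (fun g => (γ : ASL) * g) ⁻¹' U (a k), ?_, ?_⟩
  · exact MeasurableSet.iUnion fun n => (hUo _).measurableSet.diff <|
      MeasurableSet.iUnion fun k => MeasurableSet.iUnion fun γ => hmul γ (hUo _).measurableSet
  · intro g
    have hspec := Nat.find_spec (hmeet g)
    have hmin : ∀ {k}, k < Nat.find (hmeet g) → ∀ γ : Lam, (γ : ASL) * g ∉ U (a k) :=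
      fun {k} hk γ hγ => Nat.find_min (hmeet g) hk ⟨γ, hγ⟩
    obtain ⟨γ, hγ⟩ := hspec
    refine ⟨γ, ?_, ?_⟩
    · simp only [Set.mem_iUnion, Set.mem_sdiff, Set.mem_preimage, not_exists]
      refine ⟨Nat.find (hmeet g), hγ, fun k δ hδ => hmin k.2 (δ * γ) ?_⟩
      simpa [mul_assoc] using hδ
    · intro δ hδ
      simp only [Set.mem_iUnion, Set.mem_sdiff, Set.mem_preimage, not_exists] at hδ
      obtain ⟨n, hn, hk⟩ := hδ
      have hle : Nat.find (hmeet g) ≤ n := Nat.find_min' _ ⟨δ, hn⟩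
      have hge : n ≤ Nat.find (hmeet g) := by
        by_contra! hlt
        refine hk ⟨_, hlt⟩ (γ * δ⁻¹) ?_
        simpa [mul_assoc] using hγ
      obtain rfl : n = Nat.find (hmeet g) := le_antisymm hge hle
      have := hU _ _ hγ _ hn ((δ * γ⁻¹ : Lam) : ASL) (δ * γ⁻¹).2 (by simp [mul_assoc])
      rw [← Subgroup.coe_one, Subtype.coe_inj] at this
      exact mul_inv_eq_one.1 this

/-- The coset map `g ↦ Λ g`. -/
def toY (g : ASL) : YSpace := Quotient.mk _ g

theorem measurable_toY : Measurable toY := measurable_quotient_mk''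

theorem toY_eq_iff {g h : ASL} : toY g = toY h ↔ ∃ γ : Lam, (γ : ASL) * g = h := by
  rw [toY, toY, Quotient.eq, QuotientGroup.rightRel_apply]
  constructor
  · intro H
    exact ⟨⟨_, H⟩, by simp⟩
  · rintro ⟨γ, rfl⟩
    simp

theorem rightTranslate_toY (g h : ASL) : rightTranslate h (toY g) = toY (g * h) := rfl

/-- A measurable section of the projection `ASL(2,ℝ) → Y`. -/
theorem exists_measurable_section : ∃ σ : YSpace → ASL, Measurable σ ∧ ∀ y, toY (σ y) = y := by
  obtain ⟨D, hD, hex⟩ := exists_strict_fundamentalDomain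
  choose γ hγ huniq using hex
  have hinv : ∀ a b : ASL, toY a = toY b → (γ a : ASL) * a = γ b * b := by
    intro a b hab
    obtain ⟨δ, rfl⟩ := toY_eq_iff.1 hab
    have : γ (δ * a) * δ = γ a := huniq a _ (by simpa [mul_assoc] using hγ (δ * a))
    rw [← mul_assoc, ← Subgroup.coe_mul, this]
  refine ⟨Quotient.lift (fun g => (γ g : ASL) * g) fun a b hab => hinv a b (Quotient.sound hab),
    measurable_from_quotient.2 fun A hA => ?_, ?_⟩
  -- The representative is chosen without measurability; a countable union over the possible
  -- elements of `Λ` restores it.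
  · have : (fun g : ASL => (γ g : ASL) * g) ⁻¹' A =
        ⋃ δ : Lam, (fun g : ASL => (δ : ASL) * g) ⁻¹' (A ∩ D) := by
      ext g
      simp only [Set.mem_preimage, Set.mem_iUnion]
      constructor
      · exact fun h => ⟨γ g, h, hγ g⟩
      · rintro ⟨δ, h1, h2⟩
        rwa [← huniq g δ h2]
    change MeasurableSet ((fun g : ASL => (γ g : ASL) * g) ⁻¹' A)
    rw [this]
    exact MeasurableSet.iUnion fun δ => ASL.measurable_mul_left _ (hA.inter hD)
  · rintro ⟨g⟩
    exact (toY_eq_iff.2 ⟨γ g, rfl⟩).symm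

/-! ### Lifting the invariant measure to the group. -/

/-- A probability measure on `ASL(2,ℝ)` whose image on `Y` is invariant, expressed by its integrals
of left `Λ`-invariant functions. -/
structure IsInvariantLift (P : Measure ASL) : Prop where
  isProbabilityMeasure : IsProbabilityMeasure P
  lintegral_mul : ∀ Φ : ASL → ℝ≥0∞, Measurable Φ → (∀ γ ∈ Lam, ∀ g, Φ (γ * g) = Φ g) → ∀ h,
    ∫⁻ g, Φ (g * h) ∂P = ∫⁻ g, Φ g ∂P

/-- The section is not equivariant, but a left `Λ`-invariant function descends to `Y`, where right
translations preserve `μ`. -/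
theorem IsInvariantProbability.isInvariantLift {μ : Measure YSpace} (hμ : IsInvariantProbability μ)
    {σ : YSpace → ASL} (hσ : Measurable σ) (hs : ∀ y, toY (σ y) = y) :
    IsInvariantLift (μ.map σ) := by
  have := hμ.isProbabilityMeasure
  refine ⟨Measure.isProbabilityMeasure_map hσ.aemeasurable, fun Φ hΦ hinv h => ?_⟩
  let φ : YSpace → ℝ≥0∞ := fun y => Φ (σ y)
  have hφ : ∀ g, φ (toY g) = Φ g := by
    intro g
    obtain ⟨γ, hγ⟩ := toY_eq_iff.1 (hs (toY g))
    have := hinv γ γ.2 (σ (toY g))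
    rw [hγ] at this
    exact this.symm
  rw [lintegral_map hΦ hσ, lintegral_map (f := fun g => Φ (g * h))
    (hΦ.comp (ASL.measurable_mul_right h)) hσ]
  have h1 : ∀ y, Φ (σ y * h) = φ (rightTranslate h y) := by
    intro y
    conv_rhs => rw [← hs y]
    rw [rightTranslate_toY, hφ]
  simp only [h1]
  exact (hμ.invariant h).lintegral_comp (hΦ.comp hσ)

/-! ### Uniqueness of the `SL(2,ℝ)`-invariant measure on the punctured plane. -/

theorem lintegral_comp_affine (f : ℝ → ℝ≥0∞) (b : ℝ) {a : ℝ} (ha : a ≠ 0) :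
    (∫⁻ t, f (b + t * a)) * ENNReal.ofReal |a| = ∫⁻ t, f t := by
  have h1 : ∫⁻ t, f (b + t * a) = ∫⁻ t, f (b + t) ∂(Measure.map (fun t => t * a) volume) := by
    rw [(measurableEmbedding_mulRight₀ ha).lintegral_map]
  rw [h1, Real.map_volume_mul_right ha, lintegral_smul_measure, lintegral_add_left_eq_self,
    smul_eq_mul, mul_right_comm, abs_inv, ENNReal.ofReal_inv_of_pos (abs_pos.2 ha),
    ENNReal.inv_mul_cancel, one_mul]
  · simpa using ha
  · exact ENNReal.ofReal_ne_top

theorem lintegral_plane (h : Plane → ℝ≥0∞) (hh : Measurable h) :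
    ∫⁻ p, h p = ∫⁻ x : ℝ, ∫⁻ y : ℝ, h ![x, y] := by
  have e := (volume_preserving_finTwoArrow ℝ).symm
  rw [← e.lintegral_comp hh]
  exact lintegral_prod _ (hh.comp e.measurable).aemeasurable

theorem lintegral_plane_swap (h : Plane → ℝ≥0∞) (hh : Measurable h) :
    ∫⁻ p, h p = ∫⁻ y : ℝ, ∫⁻ x : ℝ, h ![x, y] := by
  have e := (volume_preserving_finTwoArrow ℝ).symm
  rw [← e.lintegral_comp hh]
  exact lintegral_prod_symm _ (hh.comp e.measurable).aemeasurable

/-- The shear `(x, y) ↦ (x, y + t x)`. -/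
def shearRight (t : ℝ) : SL(2, ℝ) := ⟨!![1, t; 0, 1], by simp⟩

/-- The shear `(x, y) ↦ (x + s y, y)`. -/
def shearLeft (s : ℝ) : SL(2, ℝ) := ⟨!![1, 0; s, 1], by simp⟩

theorem vecMul_shearRight (p : Plane) (t : ℝ) :
    p ᵥ* (shearRight t : Matrix (Fin 2) (Fin 2) ℝ) = ![p 0, p 1 + t * p 0] := by
  ext i
  rw [vecMul_apply_two]
  fin_cases i
  · simp [shearRight]
  · simp [shearRight]
    ring

theorem vecMul_shearLeft (p : Plane) (s : ℝ) :
    p ᵥ* (shearLeft s : Matrix (Fin 2) (Fin 2) ℝ) = ![p 0 + s * p 1, p 1] := by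
  ext i
  rw [vecMul_apply_two]
  fin_cases i
  · simp [shearLeft]
    ring
  · simp [shearLeft]

/-- The measure `ν` on the plane is invariant under `SL(2,ℝ)`. -/
def IsLinearInvariant (ν : Measure Plane) : Prop :=
  ∀ M : SL(2, ℝ), ∀ h : Plane → ℝ≥0∞, Measurable h →
    ∫⁻ p, h (p ᵥ* (M : Matrix (Fin 2) (Fin 2) ℝ)) ∂ν = ∫⁻ p, h p ∂ν

theorem vecMul_eq_zero_iff (p : Plane) (M : SL(2, ℝ)) :
    p ᵥ* (M : Matrix (Fin 2) (Fin 2) ℝ) = 0 ↔ p = 0 := by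
  have h := (ASL.act_injective (ASL.linear M)).eq_iff (a := p) (b := 0)
  simpa [ASL.act_linear] using h

theorem lintegral_const_real_eq_zero {c : ℝ≥0∞} (h : ∫⁻ _ : ℝ, c = 0) : c = 0 := by
  rw [lintegral_const, mul_eq_zero] at h
  simpa using h

theorem volume_affine_eq_zero {p : Plane} (hp : p ≠ 0) (i j : Fin 2) (hij : i ≠ j) :
    volume {t : ℝ | p i + t * p j = 0} = 0 := by
  by_cases hj : p j = 0
  · have hi : p i ≠ 0 := by
      intro hi
      apply hp
      ext k
      have : k = i ∨ k = j := by omega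
      rcases this with rfl | rfl <;> assumption
    simp [hj, hi]
  · refine measure_mono_null (t := {-p i / p j}) ?_ (by simp)
    intro t ht
    rw [Set.mem_singleton_iff, eq_div_iff hj]
    have : p i + t * p j = 0 := ht
    linarith

/-- A shear carries the axis to another line through the origin without changing its mass. A fixed
`p ≠ 0` lies on these lines only for a null set of shear parameters, so by Tonelli the common mass
has integral zero over `ℝ`. -/
theorem IsLinearInvariant.ae_apply_ne_zero {ν : Measure Plane} [SFinite ν]
    (hν : IsLinearInvariant ν) (h0 : ν {0} = 0) (i : Fin 2) : ∀ᵐ p ∂ν, p i ≠ 0 := by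
  have hz : ∀ᵐ p ∂ν, p ≠ 0 := by
    rw [ae_iff]
    simpa using h0
  let k : Plane → ℝ≥0∞ := Set.indicator {p | p i = 0} 1
  have hm : MeasurableSet {p : Plane | p i = 0} :=
    measurableSet_eq_fun (measurable_pi_apply i) measurable_const
  have hk : Measurable k := measurable_one.indicator hm
  obtain ⟨j, hij, S, hS⟩ : ∃ j : Fin 2, i ≠ j ∧ ∃ S : ℝ → SL(2, ℝ), ∀ t p,
      (p ᵥ* (S t : Matrix (Fin 2) (Fin 2) ℝ)) i = p i + t * p j := by
    fin_cases i
    · exact ⟨1, by simp, shearLeft, fun t p => by simp [vecMul_shearLeft]⟩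
    · exact ⟨0, by simp, shearRight, fun t p => by simp [vecMul_shearRight]⟩
  have hkS : ∀ t p, k (p ᵥ* (S t : Matrix (Fin 2) (Fin 2) ℝ)) =
      Set.indicator {q : ℝ × Plane | q.2 i + q.1 * q.2 j = 0} 1 (t, p) := by
    intro t p
    simp only [k, Set.indicator, Set.mem_ofPred_eq, hS, Pi.one_apply]
  have hm2 : MeasurableSet {q : ℝ × Plane | q.2 i + q.1 * q.2 j = 0} := by
    refine measurableSet_eq_fun ?_ measurable_const
    fun_prop
  have key : ∫⁻ _ : ℝ, ν {p | p i = 0} = 0 := by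
    calc ∫⁻ _ : ℝ, ν {p | p i = 0}
        = ∫⁻ t : ℝ, ∫⁻ p, Set.indicator {q : ℝ × Plane | q.2 i + q.1 * q.2 j = 0} 1 (t, p) ∂ν := by
          congr 1 with t
          simp only [← hkS]
          rw [hν (S t) k hk]
          exact (lintegral_indicator_one hm).symm
      _ = ∫⁻ p, (∫⁻ t : ℝ, Set.indicator {q : ℝ × Plane | q.2 i + q.1 * q.2 j = 0} 1 (t, p)) ∂ν :=
          lintegral_lintegral_swap (measurable_one.indicator hm2).aemeasurable
      _ = ∫⁻ p, 0 ∂ν := by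
          refine lintegral_congr_ae ?_
          filter_upwards [hz] with p hp
          have : ∀ t : ℝ, Set.indicator {q : ℝ × Plane | q.2 i + q.1 * q.2 j = 0}
              (1 : ℝ × Plane → ℝ≥0∞) (t, p) = Set.indicator {t : ℝ | p i + t * p j = 0} 1 t :=
            fun t => rfl
          simp only [this]
          rw [lintegral_indicator_one, volume_affine_eq_zero hp i j hij]
          exact measurableSet_eq_fun (by fun_prop) measurable_const
      _ = 0 := lintegral_zero
  rw [ae_iff]
  simpa using lintegral_const_real_eq_zero key

theorem ae_affine_ne_zero (b : ℝ) {a : ℝ} (ha : a ≠ 0) : ∀ᵐ t : ℝ, b + t * a ≠ 0 := by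
  have := volume_affine_eq_zero (p := ![b, a]) (fun h => ha (by simpa using congrFun h 1)) 0 1
    (by simp)
  rw [ae_iff]
  simpa using this

/-- Two successive shears of `p` give coordinates `(t, s)` on almost all of the plane: `y = p 1 + t
* p 0`, `x = p 0 + s * y`, with Jacobian `|y| |p 0|`. -/
theorem lintegral_shearLeft_shearRight {h : Plane → ℝ≥0∞} (hh : Measurable h) {p : Plane}
    (hp : p 0 ≠ 0) :
    (∫⁻ t : ℝ, ∫⁻ s : ℝ, h ![p 0 + s * (p 1 + t * p 0), p 1 + t * p 0] *
      ENNReal.ofReal |p 1 + t * p 0|) * ENNReal.ofReal |p 0| = ∫⁻ q, h q := by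
  rw [lintegral_plane_swap h hh, ← lintegral_comp_affine (fun y => ∫⁻ x, h ![x, y]) (p 1) hp]
  congr 1
  refine lintegral_congr_ae ?_
  filter_upwards [ae_affine_ne_zero (p 1) hp] with t ht
  rw [← lintegral_comp_affine (fun x => h ![x, p 1 + t * p 0]) (p 0) ht, lintegral_mul_const]
  refine hh.comp (measurable_pi_lambda _ fun i => ?_)
  fin_cases i
  · simp only [Fin.zero_eta, Matrix.cons_val]; fun_prop
  · simp only [Fin.mk_one, Matrix.cons_val]; fun_prop

/-- The shears are taken in the opposite order: `x = p 0 + s * p 1`, `y = p 1 + t * x`, with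
Jacobian `|x| |p 1|`. -/
theorem lintegral_shearRight_shearLeft {h : Plane → ℝ≥0∞} (hh : Measurable h) {p : Plane}
    (hp : p 1 ≠ 0) :
    (∫⁻ s : ℝ, ∫⁻ t : ℝ, h ![p 0 + s * p 1, p 1 + t * (p 0 + s * p 1)] *
      ENNReal.ofReal |p 0 + s * p 1|) * ENNReal.ofReal |p 1| = ∫⁻ q, h q := by
  rw [lintegral_plane h hh, ← lintegral_comp_affine (fun x => ∫⁻ y, h ![x, y]) (p 0) hp]
  congr 1
  refine lintegral_congr_ae ?_
  filter_upwards [ae_affine_ne_zero (p 0) hp] with s hs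
  rw [← lintegral_comp_affine (fun y => h ![p 0 + s * p 1, y]) (p 1) hs, lintegral_mul_const]
  refine hh.comp (measurable_pi_lambda _ fun i => ?_)
  fin_cases i
  · simp only [Fin.zero_eta, Matrix.cons_val]; fun_prop
  · simp only [Fin.mk_one, Matrix.cons_val]; fun_prop

theorem lintegral_neg_real (f : ℝ → ℝ≥0∞) : ∫⁻ t, f (-t) = ∫⁻ t, f t := by
  simpa using lintegral_comp_affine f 0 (a := -1) (by norm_num)

/-- Up to a constant, Lebesgue measure is the only `SL(2,ℝ)`-invariant measure on the plane that
does not charge the origin. -/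
theorem IsLinearInvariant.lintegral_mul_lintegral {ν : Measure Plane} [SFinite ν]
    (hν : IsLinearInvariant ν) (h0 : ν {0} = 0) {h w : Plane → ℝ≥0∞} (hh : Measurable h)
    (hw : Measurable w) :
    (∫⁻ p, h p ∂ν) * ∫⁻ p, w p = (∫⁻ p, w p ∂ν) * ∫⁻ p, h p := by
  -- The weights `|p 1|` and `|p 0|` make up the Jacobians of both shear parametrizations at once:
  -- in `W p * F (R s t p)` they give `|p 0| |p 1 + t * p 0|`, in `W (L s t p) * F p` they give `|p
  -- 0 + s * p 1| |p 1|`. Integrating one quantity over `s`, `t` and `ν` in two ways then gives the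
  -- two sides.
  let F : Plane → ℝ≥0∞ := fun p => h p * ENNReal.ofReal |p 1|
  let W : Plane → ℝ≥0∞ := fun p => w p * ENNReal.ofReal |p 0|
  have hF : Measurable F := hh.mul (by fun_prop)
  have hW : Measurable W := hw.mul (by fun_prop)
  let R : ℝ → ℝ → Plane → Plane := fun s t p =>
    ![p 0 + s * (p 1 + t * p 0), p 1 + t * p 0]
  let L : ℝ → ℝ → Plane → Plane := fun s t p =>
    ![p 0 + s * p 1, p 1 + t * (p 0 + s * p 1)]
  have hR : Measurable fun q : ℝ × ℝ × Plane => R q.2.1 q.1 q.2.2 := by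
    refine measurable_pi_lambda _ fun i => ?_
    fin_cases i <;> simp [R] <;> fun_prop
  have hL : Measurable fun q : ℝ × ℝ × Plane => L q.1 q.2.1 q.2.2 := by
    refine measurable_pi_lambda _ fun i => ?_
    fin_cases i <;> simp [L] <;> fun_prop
  -- `L (-s) (-t)` is the inverse of `R s t`, which acts by an element of `SL(2,ℝ)`.
  have hinv : ∀ s t, ∫⁻ p, W p * F (R s t p) ∂ν = ∫⁻ p, W (L (-s) (-t) p) * F p ∂ν := by
    intro s t
    have hk : Measurable fun p => W (L (-s) (-t) p) * F p :=
      (hW.comp (hL.comp (measurable_const.prodMk (measurable_const.prodMk measurable_id)))).mul hF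
    rw [← hν (shearRight t * shearLeft s) _ hk]
    congr 1 with p
    have e : p ᵥ* ((shearRight t * shearLeft s : SL(2, ℝ)) : Matrix (Fin 2) (Fin 2) ℝ) =
        R s t p := by
      rw [Matrix.SpecialLinearGroup.coe_mul, ← Matrix.vecMul_vecMul, vecMul_shearRight,
        vecMul_shearLeft]
      simp [R]
    rw [e]
    congr 2
    ext i
    fin_cases i
    · simp [L, R]
    · simp [L, R]
  have hL1 : ∫⁻ t : ℝ, ∫⁻ s : ℝ, ∫⁻ p, W p * F (R s t p) ∂ν = (∫⁻ p, w p ∂ν) * ∫⁻ p, h p := by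
    have hm : Measurable fun q : ℝ × ℝ × Plane => W q.2.2 * F (R q.2.1 q.1 q.2.2) :=
      (hW.comp measurable_snd.snd).mul (hF.comp hR)
    calc ∫⁻ t : ℝ, ∫⁻ s : ℝ, ∫⁻ p, W p * F (R s t p) ∂ν
        = ∫⁻ t : ℝ, ∫⁻ p, (∫⁻ s : ℝ, W p * F (R s t p)) ∂ν := by
          congr 1 with t
          refine lintegral_lintegral_swap (Measurable.aemeasurable ?_)
          exact hm.comp (measurable_const.prodMk measurable_id)
      _ = ∫⁻ p, (∫⁻ t : ℝ, ∫⁻ s : ℝ, W p * F (R s t p)) ∂ν := by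
          refine lintegral_lintegral_swap (Measurable.aemeasurable ?_)
          have : Measurable fun q : (ℝ × Plane) × ℝ => W q.1.2 * F (R q.2 q.1.1 q.1.2) :=
            hm.comp (measurable_fst.fst.prodMk (measurable_snd.prodMk measurable_fst.snd))
          exact this.lintegral_prod_right'
      _ = ∫⁻ p, (w p * ∫⁻ q, h q) ∂ν := by
          refine lintegral_congr_ae ?_
          filter_upwards [hν.ae_apply_ne_zero h0 0] with p hp
          rw [← lintegral_shearLeft_shearRight hh hp]
          have hmp : Measurable fun q : ℝ × ℝ => F (R q.2 q.1 p) :=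
            hF.comp (hR.comp (measurable_fst.prodMk (measurable_snd.prodMk measurable_const)))
          have hs : ∀ t, Measurable fun s => F (R s t p) := fun t =>
            hmp.comp (measurable_const.prodMk measurable_id)
          have e : ∀ t, ∫⁻ s, W p * F (R s t p) = W p * ∫⁻ s, F (R s t p) := fun t =>
            lintegral_const_mul (W p) (hs t)
          simp only [e]
          rw [lintegral_const_mul _ hmp.lintegral_prod_right']
          change w p * ENNReal.ofReal |p 0| * (∫⁻ t, ∫⁻ s, F (R s t p)) =
            w p * ((∫⁻ t, ∫⁻ s, F (R s t p)) * ENNReal.ofReal |p 0|)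
          ring
      _ = _ := lintegral_mul_const _ hw
  have hL2 : ∫⁻ s : ℝ, ∫⁻ t : ℝ, ∫⁻ p, W (L (-s) (-t) p) * F p ∂ν =
      (∫⁻ p, h p ∂ν) * ∫⁻ p, w p := by
    have hm : Measurable fun q : ℝ × ℝ × Plane => W (L q.1 q.2.1 q.2.2) * F q.2.2 :=
      (hW.comp hL).mul (hF.comp measurable_snd.snd)
    calc ∫⁻ s : ℝ, ∫⁻ t : ℝ, ∫⁻ p, W (L (-s) (-t) p) * F p ∂ν
        = ∫⁻ s : ℝ, ∫⁻ t : ℝ, ∫⁻ p, W (L s t p) * F p ∂ν := by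
          rw [← lintegral_neg_real]
          congr 1 with s
          rw [← lintegral_neg_real]
          simp only [neg_neg]
      _ = ∫⁻ s : ℝ, ∫⁻ p, (∫⁻ t : ℝ, W (L s t p) * F p) ∂ν := by
          congr 1 with s
          refine lintegral_lintegral_swap (Measurable.aemeasurable ?_)
          exact hm.comp (measurable_const.prodMk measurable_id)
      _ = ∫⁻ p, (∫⁻ s : ℝ, ∫⁻ t : ℝ, W (L s t p) * F p) ∂ν := by
          refine lintegral_lintegral_swap (Measurable.aemeasurable ?_)
          have : Measurable fun q : (ℝ × Plane) × ℝ => W (L q.1.1 q.2 q.1.2) * F q.1.2 :=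
            hm.comp (measurable_fst.fst.prodMk (measurable_snd.prodMk measurable_fst.snd))
          exact this.lintegral_prod_right'
      _ = ∫⁻ p, (h p * ∫⁻ q, w q) ∂ν := by
          refine lintegral_congr_ae ?_
          filter_upwards [hν.ae_apply_ne_zero h0 1] with p hp
          rw [← lintegral_shearRight_shearLeft hw hp]
          have hmp : Measurable fun q : ℝ × ℝ => W (L q.1 q.2 p) :=
            hW.comp (hL.comp (measurable_fst.prodMk (measurable_snd.prodMk measurable_const)))
          have hs : ∀ s, Measurable fun t => W (L s t p) := fun s =>
            hmp.comp (measurable_const.prodMk measurable_id)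
          have e : ∀ s, ∫⁻ t, W (L s t p) * F p = (∫⁻ t, W (L s t p)) * F p := fun s =>
            lintegral_mul_const (F p) (hs s)
          simp only [e]
          rw [lintegral_mul_const _ hmp.lintegral_prod_right']
          change (∫⁻ s, ∫⁻ t, W (L s t p)) * (h p * ENNReal.ofReal |p 1|) =
            h p * ((∫⁻ s, ∫⁻ t, W (L s t p)) * ENNReal.ofReal |p 1|)
          ring
      _ = _ := lintegral_mul_const _ hh
  rw [← hL1, ← hL2]
  simp only [← hinv]
  refine (lintegral_lintegral_swap (Measurable.aemeasurable ?_)).symm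
  have : Measurable fun q : (ℝ × ℝ) × Plane => W q.2 * F (R q.1.2 q.1.1 q.2) :=
    (hW.comp measurable_snd).mul (hF.comp (hR.comp
      (measurable_fst.fst.prodMk (measurable_fst.snd.prodMk measurable_snd))))
  exact this.lintegral_prod_right'

/-! ### Counting lattice points in squares. -/

/-- The indicator function of the square `[-r, r]²`. -/
def square (r : ℝ) : Plane → ℝ≥0∞ := (Metric.closedBall (0 : Plane) r).indicator 1

@[fun_prop]
theorem measurable_square (r : ℝ) : Measurable (square r) :=
  measurable_one.indicator Metric.isClosed_closedBall.measurableSet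

theorem square_apply_le (r : ℝ) (x : Plane) : square r x ≤ 1 := by
  unfold square
  exact Set.indicator_le_self' (by simp) x

theorem square_of_norm_le {r : ℝ} {x : Plane} (h : ‖x‖ ≤ r) : square r x = 1 :=
  Set.indicator_of_mem (mem_closedBall_zero_iff.2 h) _

theorem square_of_lt_norm {r : ℝ} {x : Plane} (h : r < ‖x‖) : square r x = 0 :=
  Set.indicator_of_notMem (fun h' => h.not_ge (mem_closedBall_zero_iff.1 h')) _

theorem square_le_square {r s : ℝ} {x y : Plane} (h : ‖x‖ ≤ r → ‖y‖ ≤ s) :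
    square r x ≤ square s y := by
  by_cases hx : ‖x‖ ≤ r
  · rw [square_of_norm_le hx, square_of_norm_le (h hx)]
  · rw [square_of_lt_norm (not_le.1 hx)]
    exact zero_le

theorem lintegral_square {r : ℝ} (hr : 0 ≤ r) :
    ∫⁻ x, square r x = ENNReal.ofReal ((2 * r) ^ 2) := by
  unfold square
  rw [lintegral_indicator_one Metric.isClosed_closedBall.measurableSet,
    Real.volume_pi_closedBall _ hr, Fintype.card_fin]

theorem norm_plane_le {x : Plane} {r : ℝ} (hr : 0 ≤ r) : ‖x‖ ≤ r ↔ |x 0| ≤ r ∧ |x 1| ≤ r := by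
  rw [pi_norm_le_iff_of_nonneg hr, Fin.forall_fin_two]
  rfl

/-- The number of points of `ℤ² M` in `[-1, 1]²`, where `M` is the linear part of `g`. -/
def shortCount (g : ASL) : ℝ≥0∞ :=
  ∑' n : Fin 2 → ℤ, square 1 (intVec n ᵥ* (g.lin : Matrix (Fin 2) (Fin 2) ℝ))

theorem measurable_tsum_comp {J : Type*} [Countable J] {α β : Type*} [MeasurableSpace α]
    [MeasurableSpace β] {h : β → ℝ≥0∞} (hh : Measurable h) {q : J → α → β}
    (hq : ∀ j, Measurable (q j)) : Measurable fun a => ∑' j, h (q j a) :=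
  Measurable.tsum fun j => hh.comp (hq j)

@[fun_prop]
theorem measurable_shortCount : Measurable shortCount :=
  measurable_tsum_comp (measurable_square 1) fun _ => measurable_vecMul_lin _

/-- The number of points of a lattice translate in a square, bounded by the number of unit cells. -/
theorem tsum_square_le (x : Plane) (g : ASL) (R : ℕ) :
    ∑' m : Fin 2 → ℤ, square R (x + intVec m ᵥ* (g.lin : Matrix (Fin 2) (Fin 2) ℝ)) ≤
      (2 * R + 1) ^ 2 * shortCount g := by
  classical
  let p : (Fin 2 → ℤ) → Plane := fun m => x + intVec m ᵥ* (g.lin : Matrix (Fin 2) (Fin 2) ℝ)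
  let fl : Plane → Fin 2 → ℤ := fun y i => ⌊y i⌋
  -- The floors of coordinates in the closed interval `[-R, R]` take `2R + 1` values, the endpoint
  -- `R` included.
  let S : Finset (Fin 2 → ℤ) := Fintype.piFinset fun _ => Finset.Icc (-R : ℤ) R
  have hcard : (S.card : ℝ≥0∞) = (2 * R + 1) ^ 2 := by
    have : S.card = (2 * R + 1) ^ 2 := by
      rw [Fintype.card_piFinset_const, Int.card_Icc]
      congr 1
      omega
    rw [this]
    push_cast
    rfl
  -- Two points in one unit cell differ by a lattice vector in `[-1, 1]²`; subtracting a fixed point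
  -- of the cell injects the others into the vectors counted by `shortCount`.
  have hcell : ∀ c : Fin 2 → ℤ, ∑' m, (if fl (p m) = c then (1 : ℝ≥0∞) else 0) ≤ shortCount g := by
    intro c
    by_cases h : ∃ m₀, fl (p m₀) = c
    · obtain ⟨m₀, hm₀⟩ := h
      rw [shortCount, ← (Equiv.subRight m₀).tsum_eq fun n : Fin 2 → ℤ =>
        square 1 (intVec n ᵥ* (g.lin : Matrix (Fin 2) (Fin 2) ℝ))]
      refine ENNReal.tsum_le_tsum fun m => ?_
      split_ifs with hm
      · rw [Equiv.subRight_apply, square_of_norm_le]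
        rw [norm_plane_le zero_le_one]
        have key : ∀ i, |(intVec (m - m₀) ᵥ* (g.lin : Matrix (Fin 2) (Fin 2) ℝ)) i| ≤ 1 := by
          intro i
          have e : (intVec (m - m₀) ᵥ* (g.lin : Matrix (Fin 2) (Fin 2) ℝ)) i = p m i - p m₀ i := by
            simp [p, intVec_sub, Matrix.sub_vecMul]
          have h1 : ⌊p m i⌋ = ⌊p m₀ i⌋ := (congrFun hm i).trans (congrFun hm₀ i).symm
          rw [e]
          exact (Int.abs_sub_lt_one_of_floor_eq_floor h1).le
        exact ⟨key 0, key 1⟩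
      · exact zero_le
    · push Not at h
      simp [h]
  calc ∑' m, square R (p m)
      ≤ ∑' m, ∑ c ∈ S, (if fl (p m) = c then (1 : ℝ≥0∞) else 0) := by
        refine ENNReal.tsum_le_tsum fun m => ?_
        by_cases hm : ‖p m‖ ≤ R
        · rw [square_of_norm_le hm, Finset.sum_ite_eq, if_pos]
          rw [norm_plane_le (Nat.cast_nonneg R)] at hm
          have key : ∀ i, ⌊p m i⌋ ∈ Finset.Icc (-R : ℤ) R := by
            intro i
            have hi : |p m i| ≤ R := by
              fin_cases i
              · exact hm.1
              · exact hm.2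
            rw [abs_le] at hi
            rw [Finset.mem_Icc]
            refine ⟨Int.le_floor.2 (by push_cast; exact hi.1), ?_⟩
            have := (Int.floor_le (p m i)).trans hi.2
            exact_mod_cast this
          exact Fintype.mem_piFinset.2 key
        · rw [square_of_lt_norm (not_le.1 hm)]
          exact zero_le
    _ = ∑ c ∈ S, ∑' m, (if fl (p m) = c then (1 : ℝ≥0∞) else 0) :=
        Summable.tsum_finsetSum fun _ _ => ENNReal.summable
    _ ≤ ∑ _c ∈ S, shortCount g := Finset.sum_le_sum fun c _ => hcell c
    _ = _ := by rw [Finset.sum_const, nsmul_eq_mul, hcard]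

/-- This is the domination, uniform in `R` and in the translate, for the density limit. The factor 4
comes from `2(R+1) + 1 ≤ 2 · 2(R+1)`; the radius `R + 1` avoids a square of area zero. -/
theorem tsum_square_div_le (x : Plane) (g : ASL) (R : ℕ) :
    (∑' m : Fin 2 → ℤ, square (R + 1 : ℕ) (x + intVec m ᵥ* (g.lin : Matrix (Fin 2) (Fin 2) ℝ))) /
      ENNReal.ofReal ((2 * (R + 1 : ℕ)) ^ 2) ≤ 4 * shortCount g := by
  have hpos : (0 : ℝ) < (2 * (R + 1 : ℕ)) ^ 2 := by positivity
  refine ENNReal.div_le_of_le_mul ((tsum_square_le x g (R + 1)).trans ?_)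
  rw [mul_right_comm]
  gcongr
  have e : ENNReal.ofReal ((2 * (R + 1 : ℕ)) ^ 2) = ((2 * (R + 1)) ^ 2 : ℕ) := by
    rw [← ENNReal.ofReal_natCast]
    push_cast
    rfl
  rw [e]
  have h : (2 * (R + 1) + 1) ^ 2 ≤ 4 * (2 * (R + 1)) ^ 2 :=
    calc (2 * (R + 1) + 1) ^ 2 ≤ (2 * (2 * (R + 1))) ^ 2 := Nat.pow_le_pow_left (by omega) 2
      _ = _ := by ring
  exact_mod_cast h

theorem volume_floor_eq (m : Fin 2 → ℤ) :
    volume ((fun (y : Plane) (i : Fin 2) => ⌊y i⌋) ⁻¹' {m}) = 1 := by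
  have : (fun (y : Plane) (i : Fin 2) => ⌊y i⌋) ⁻¹' {m} =
      Set.univ.pi fun i => Set.Ico (m i : ℝ) (m i + 1) := by
    ext y
    simp only [Set.mem_preimage, Set.mem_singleton_iff, funext_iff, Set.mem_univ_pi, Set.mem_Ico,
      Int.floor_eq_iff]
  rw [this, volume_pi, Measure.pi_pi]
  simp

/-- The cells of constant floor have area one, so a lattice sum becomes an integral that can be
compared with an area. -/
theorem lintegral_comp_floor (G : (Fin 2 → ℤ) → ℝ≥0∞) :
    ∫⁻ y : Plane, G (fun i => ⌊y i⌋) = ∑' m, G m := by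
  have hfl : Measurable fun (y : Plane) (i : Fin 2) => ⌊y i⌋ :=
    measurable_pi_lambda _ fun i => Int.measurable_floor.comp (measurable_pi_apply i)
  rw [← lintegral_map (f := G) (measurable_of_countable G) hfl, lintegral_countable']
  congr 1 with m
  rw [Measure.map_apply hfl (measurableSet_singleton m), volume_floor_eq, mul_one]

theorem lintegral_square_act (g : ASL) {r : ℝ} (hr : 0 ≤ r) :
    ∫⁻ y, square r (ASL.act y g) = ENNReal.ofReal ((2 * r) ^ 2) := by
  rw [(measurePreserving_act g).lintegral_comp (measurable_square r), lintegral_square hr]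

/-- The translates of a unimodular lattice have density one. -/
theorem tendsto_tsum_square_div (x : Plane) (g : ASL) :
    Tendsto (fun R : ℕ =>
      (∑' m : Fin 2 → ℤ, square (R + 1 : ℕ) (x + intVec m ᵥ* (g.lin : Matrix (Fin 2) (Fin 2) ℝ))) /
        ENNReal.ofReal ((2 * (R + 1 : ℕ)) ^ 2)) atTop (𝓝 1) := by
  let D : ℝ := ∑ i, ∑ j, |g.lin i j|
  have hD : ∀ i j, |g.lin i j| ≤ D := fun i j =>
    (Finset.single_le_sum (f := fun j => |g.lin i j|) (fun _ _ => abs_nonneg _)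
      (Finset.mem_univ j)).trans
      (Finset.single_le_sum (f := fun i => ∑ j, |g.lin i j|)
        (fun _ _ => Finset.sum_nonneg fun _ _ => abs_nonneg _) (Finset.mem_univ i))
  have hD0 : 0 ≤ D := (abs_nonneg _).trans (hD 0 0)
  let a : ASL := ⟨g.lin, x⟩
  let fl : Plane → Fin 2 → ℤ := fun y i => ⌊y i⌋
  -- Rounding `y` to its floor moves its image by at most `2D`. Hence the count in the square of
  -- radius `R` lies between the areas of the squares of radii `R - 2D` and `R + 2D`.
  have hclose : ∀ y : Plane, ‖ASL.act y a - ASL.act (intVec (fl y)) a‖ ≤ 2 * D := by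
    intro y
    rw [ASL.act_sub_act, pi_norm_le_iff_of_nonneg (by positivity)]
    intro j
    rw [vecMul_apply_two, Real.norm_eq_abs]
    have h : ∀ i, |(y - intVec (fl y)) i| ≤ 1 := by
      intro i
      change |y i - ⌊y i⌋| ≤ 1
      have := Int.fract_nonneg (y i)
      have := Int.fract_lt_one (y i)
      rw [abs_le]
      constructor <;> unfold Int.fract at * <;> linarith
    calc |(y - intVec (fl y)) 0 * g.lin 0 j + (y - intVec (fl y)) 1 * g.lin 1 j|
        ≤ |(y - intVec (fl y)) 0| * |g.lin 0 j| + |(y - intVec (fl y)) 1| * |g.lin 1 j| := by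
          rw [← abs_mul, ← abs_mul]
          exact abs_add_le _ _
      _ ≤ 1 * D + 1 * D := by
          gcongr
          · exact h 0
          · exact hD 0 j
          · exact h 1
          · exact hD 1 j
      _ = 2 * D := by ring
  have hact : ∀ m, ASL.act (intVec m) a = x + intVec m ᵥ* (g.lin : Matrix (Fin 2) (Fin 2) ℝ) :=
    fun m => add_comm _ _
  have hcount : ∀ R : ℝ, ∑' m : Fin 2 → ℤ, square R (x + intVec m ᵥ*
      (g.lin : Matrix (Fin 2) (Fin 2) ℝ)) = ∫⁻ y, square R (ASL.act (intVec (fl y)) a) := by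
    intro R
    rw [lintegral_comp_floor fun m => square R (ASL.act (intVec m) a)]
    simp only [hact]
  have hlow : ∀ R : ℝ, 2 * D ≤ R → ENNReal.ofReal ((2 * (R - 2 * D)) ^ 2) ≤
      ∑' m : Fin 2 → ℤ, square R (x + intVec m ᵥ* (g.lin : Matrix (Fin 2) (Fin 2) ℝ)) := by
    intro R hR
    rw [hcount, ← lintegral_square_act a (sub_nonneg.2 hR)]
    refine lintegral_mono fun y => square_le_square fun hy => ?_
    have := norm_sub_norm_le (ASL.act (intVec (fl y)) a) (ASL.act y a)
    rw [norm_sub_rev] at this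
    linarith [hclose y]
  have hup : ∀ R : ℝ, 0 ≤ R →
      ∑' m : Fin 2 → ℤ, square R (x + intVec m ᵥ* (g.lin : Matrix (Fin 2) (Fin 2) ℝ)) ≤
      ENNReal.ofReal ((2 * (R + 2 * D)) ^ 2) := by
    intro R hR
    rw [hcount, ← lintegral_square_act a (by positivity)]
    refine lintegral_mono fun y => square_le_square fun hy => ?_
    have := norm_sub_norm_le (ASL.act y a) (ASL.act (intVec (fl y)) a)
    linarith [hclose y]
  have hlim : ∀ c : ℝ, Tendsto (fun R : ℕ => ENNReal.ofReal ((2 * ((R + 1 : ℕ) + c)) ^ 2) /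
      ENNReal.ofReal ((2 * (R + 1 : ℕ)) ^ 2)) atTop (𝓝 1) := by
    intro c
    have h1 : Tendsto (fun R : ℕ => (1 + c / (R + 1 : ℕ)) ^ 2) atTop (𝓝 ((1 + 0) ^ 2)) :=
      ((tendsto_const_nhds.add ((tendsto_const_div_atTop_nhds_zero_nat c).comp
        (tendsto_add_atTop_nat 1))).pow 2)
    have h2 := (ENNReal.continuous_ofReal.tendsto _).comp h1
    simp only [add_zero, one_pow, ENNReal.ofReal_one] at h2
    refine h2.congr fun R => ?_
    have hpos : (0 : ℝ) < (R + 1 : ℕ) := by positivity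
    rw [Function.comp_apply, ← ENNReal.ofReal_div_of_pos (by positivity)]
    congr 1
    field_simp
  refine tendsto_of_tendsto_of_tendsto_of_le_of_le' (hlim (-(2 * D))) (hlim (2 * D)) ?_ ?_
  · have : ∀ᶠ R : ℕ in atTop, 2 * D ≤ R := tendsto_natCast_atTop_atTop.eventually_ge_atTop _
    filter_upwards [this] with R hR
    rw [← sub_eq_add_neg]
    gcongr
    refine hlow _ ?_
    push_cast
    linarith
  · refine Eventually.of_forall fun R => ?_
    gcongr
    exact hup _ (Nat.cast_nonneg _)

/-! ### Siegel's mean value formula. -/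

/-- The linear parts of the elements of `Λ` permute the family of vectors `a`. -/
def IsPermuted {J : Type*} (a : J → Plane) : Prop :=
  ∀ γ ∈ Lam, ∃ e : Equiv.Perm J, ∀ j, a j ᵥ* (γ.lin : Matrix (Fin 2) (Fin 2) ℝ) = a (e j)

theorem vecMul_mul_lin (x : Plane) (g h : ASL) :
    x ᵥ* ((g * h).lin : Matrix (Fin 2) (Fin 2) ℝ) =
      x ᵥ* (g.lin : Matrix (Fin 2) (Fin 2) ℝ) ᵥ* (h.lin : Matrix (Fin 2) (Fin 2) ℝ) := by
  rw [ASL.mul_lin, Matrix.SpecialLinearGroup.coe_mul, Matrix.vecMul_vecMul]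

theorem IsPermuted.tsum_mul {J : Type*} {a : J → Plane} (ha : IsPermuted a) (h : Plane → ℝ≥0∞)
    {γ : ASL} (hγ : γ ∈ Lam) (g : ASL) :
    ∑' j, h (a j ᵥ* ((γ * g).lin : Matrix (Fin 2) (Fin 2) ℝ)) =
      ∑' j, h (a j ᵥ* (g.lin : Matrix (Fin 2) (Fin 2) ℝ)) := by
  obtain ⟨e, he⟩ := ha γ hγ
  simp only [vecMul_mul_lin, he]
  exact e.tsum_eq fun j => h (a j ᵥ* (g.lin : Matrix (Fin 2) (Fin 2) ℝ))

theorem measurable_tsum_lin {J : Type*} [Countable J] (a : J → Plane) {h : Plane → ℝ≥0∞}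
    (hh : Measurable h) :
    Measurable fun g : ASL => ∑' j, h (a j ᵥ* (g.lin : Matrix (Fin 2) (Fin 2) ℝ)) :=
  measurable_tsum_comp hh fun _ => measurable_vecMul_lin _

/-- The intensity measure of the random family of vectors `a j M`. -/
def orbitMeasure {J : Type*} (P : Measure ASL) (a : J → Plane) : Measure Plane :=
  Measure.sum fun j => P.map fun g => a j ᵥ* (g.lin : Matrix (Fin 2) (Fin 2) ℝ)

theorem lintegral_orbitMeasure {J : Type*} [Countable J] (P : Measure ASL) (a : J → Plane)
    {h : Plane → ℝ≥0∞} (hh : Measurable h) :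
    ∫⁻ p, h p ∂(orbitMeasure P a) =
      ∫⁻ g, ∑' j, h (a j ᵥ* (g.lin : Matrix (Fin 2) (Fin 2) ℝ)) ∂P := by
  rw [orbitMeasure, lintegral_sum_measure, lintegral_tsum]
  · congr 1 with j
    rw [lintegral_map hh (measurable_vecMul_lin _)]
  · exact fun j => (hh.comp (measurable_vecMul_lin _)).aemeasurable

/-- Summing over a permuted family gives a left `Λ`-invariant function of `g`, to which the right
invariance of the lift under linear elements applies. -/
theorem isLinearInvariant_orbitMeasure {J : Type*} [Countable J] {P : Measure ASL}
    (hP : IsInvariantLift P) {a : J → Plane} (ha : IsPermuted a) :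
    IsLinearInvariant (orbitMeasure P a) := by
  intro M h hh
  rw [lintegral_orbitMeasure P a hh,
    lintegral_orbitMeasure P a (h := fun p => h (p ᵥ* (M : Matrix (Fin 2) (Fin 2) ℝ)))
      (hh.comp (measurable_vecMul M)),
    ← hP.lintegral_mul _ (measurable_tsum_lin a hh) (fun γ hγ g => ha.tsum_mul h hγ g)
      (ASL.linear M)]
  simp only [vecMul_mul_lin]
  rfl

/-- A mean value formula of Siegel's type, up to the normalization. -/
theorem IsInvariantLift.lintegral_tsum_mul_lintegral {J : Type*} [Countable J] {P : Measure ASL}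
    (hP : IsInvariantLift P) {a : J → Plane} (ha : IsPermuted a) (ha0 : ∀ j, a j ≠ 0)
    {h w : Plane → ℝ≥0∞} (hh : Measurable h) (hw : Measurable w) :
    (∫⁻ g, ∑' j, h (a j ᵥ* (g.lin : Matrix (Fin 2) (Fin 2) ℝ)) ∂P) * ∫⁻ p, w p =
      (∫⁻ g, ∑' j, w (a j ᵥ* (g.lin : Matrix (Fin 2) (Fin 2) ℝ)) ∂P) * ∫⁻ p, h p := by
  have := hP.isProbabilityMeasure
  have hs : SFinite (orbitMeasure P a) := by
    unfold orbitMeasure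
    infer_instance
  rw [← lintegral_orbitMeasure P a hh, ← lintegral_orbitMeasure P a hw]
  refine (isLinearInvariant_orbitMeasure hP ha).lintegral_mul_lintegral ?_ hh hw
  rw [orbitMeasure, Measure.sum_apply _ (measurableSet_singleton _), ENNReal.tsum_eq_zero]
  intro j
  rw [Measure.map_apply (measurable_vecMul_lin _) (measurableSet_singleton _)]
  convert measure_empty (μ := P)
  ext g
  simp [vecMul_eq_zero_iff, ha0 j]

theorem Lam.lin_eq {γ : ASL} (hγ : γ ∈ Lam) : ∃ M : SL(2, ℤ), γ.lin = M ∧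
    ∀ n : Fin 2 → ℤ, intVec n ᵥ* (γ.lin : Matrix (Fin 2) (Fin 2) ℝ) =
      intVec (n ᵥ* (M : Matrix (Fin 2) (Fin 2) ℤ)) := by
  obtain ⟨M, -, k, rfl⟩ := hγ
  refine ⟨M, rfl, fun n => ?_⟩
  have h := intVec_act n M k
  rw [intVec_add] at h
  exact add_right_cancel h

/-- The primitive integer vectors. -/
abbrev PrimitiveVec : Type := {n : Fin 2 → ℤ // IsCoprime (n 0) (n 1)}

theorem isPermuted_primitiveVec : IsPermuted fun n : PrimitiveVec => intVec n := by
  intro γ hγ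
  obtain ⟨M, -, hM⟩ := Lam.lin_eq hγ
  have hinv : ∀ (A B : SL(2, ℤ)) (n : Fin 2 → ℤ), A * B = 1 →
      n ᵥ* (A : Matrix (Fin 2) (Fin 2) ℤ) ᵥ* (B : Matrix (Fin 2) (Fin 2) ℤ) = n := by
    intro A B n h
    rw [Matrix.vecMul_vecMul, ← Matrix.SpecialLinearGroup.coe_mul, h]
    simp
  exact ⟨⟨fun n => ⟨n.1 ᵥ* (M : Matrix (Fin 2) (Fin 2) ℤ), n.2.vecMulSL M⟩,
    fun n => ⟨n.1 ᵥ* ((M⁻¹ : SL(2, ℤ)) : Matrix (Fin 2) (Fin 2) ℤ), n.2.vecMulSL M⁻¹⟩,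
    fun n => Subtype.ext (hinv M M⁻¹ n (mul_inv_cancel M)),
    fun n => Subtype.ext (hinv M⁻¹ M n (inv_mul_cancel M))⟩, fun n => hM n⟩

theorem intVec_eq_zero_iff {n : Fin 2 → ℤ} : intVec n = 0 ↔ n = 0 := by
  have h : intVec 0 = 0 := by
    ext i
    simp [intVec]
  rw [← h, intVec_injective.eq_iff]

theorem primitiveVec_ne_zero (n : PrimitiveVec) : intVec n ≠ 0 := by
  rw [Ne, intVec_eq_zero_iff]
  intro h
  have := n.2
  rw [h] at this
  exact not_isCoprime_zero_zero this

/-- Two primitive vectors with vanishing determinant agree up to the sign. -/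
theorem eq_or_eq_neg_of_isCoprime {m n : Fin 2 → ℤ} (hm : IsCoprime (m 0) (m 1))
    (hn : IsCoprime (n 0) (n 1)) (h : m 0 * n 1 = m 1 * n 0) : n = m ∨ n = -m := by
  obtain ⟨a, ha⟩ : ∃ a, n = a • m := by
    obtain ⟨u, v, huv⟩ := hm
    -- The factor is the Bézout functional of `m` evaluated at `n`; coprimality of `n` then makes it
    -- a unit.
    refine ⟨u * n 0 + v * n 1, ?_⟩
    ext i
    fin_cases i
    · simp only [Fin.zero_eta, Pi.smul_apply, smul_eq_mul]
      linear_combination (-n 0) * huv - v * h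
    · simp only [Fin.mk_one, Pi.smul_apply, smul_eq_mul]
      linear_combination (-n 1) * huv + u * h
  have hu : IsUnit a := by
    obtain ⟨u, v, huv⟩ := hn
    refine isUnit_of_dvd_one ⟨u * m 0 + v * m 1, ?_⟩
    rw [ha] at huv
    simp only [Pi.smul_apply, smul_eq_mul] at huv
    linear_combination -huv
  rcases Int.isUnit_iff.1 hu with rfl | rfl
  · left
    simpa using ha
  · right
    simpa using ha

/-- A unimodular lattice has at most two primitive vectors in a small square. -/
theorem tsum_primitiveVec_le (g : ASL) : ∑' n : PrimitiveVec,
    square (1 / 2) (intVec n ᵥ* (g.lin : Matrix (Fin 2) (Fin 2) ℝ)) ≤ 2 := by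
  classical
  by_cases h : ∃ m : PrimitiveVec, ‖intVec m ᵥ* (g.lin : Matrix (Fin 2) (Fin 2) ℝ)‖ ≤ 1 / 2
  · obtain ⟨m, hm⟩ := h
    let m' : PrimitiveVec := ⟨-m.1, by simpa using m.2.neg_neg⟩
    rw [tsum_eq_sum (s := {m, m'})]
    · calc _ ≤ ∑ _n ∈ ({m, m'} : Finset PrimitiveVec), (1 : ℝ≥0∞) :=
            Finset.sum_le_sum fun n _ => square_apply_le _ _
        _ ≤ 2 := by
            rw [Finset.sum_const, nsmul_eq_mul, mul_one]
            exact_mod_cast Finset.card_le_two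
    · intro n hn
      refine square_of_lt_norm (not_le.1 fun hn' => hn ?_)
      rw [norm_plane_le (by norm_num), vecMul_apply_two, vecMul_apply_two] at hm hn'
      have hd := det_eq_one g.lin
      -- The determinant of two integer vectors is unchanged by the unimodular map. With image
      -- entries at most `1/2` it is at most `1/4 + 1/4` in absolute value, so it vanishes.
      have hdet : (((m.1 0 * n.1 1 - m.1 1 * n.1 0 : ℤ) : ℝ)) =
          (intVec m 0 * g.lin 0 0 + intVec m 1 * g.lin 1 0) *
            (intVec n 0 * g.lin 0 1 + intVec n 1 * g.lin 1 1) -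
          (intVec m 0 * g.lin 0 1 + intVec m 1 * g.lin 1 1) *
            (intVec n 0 * g.lin 0 0 + intVec n 1 * g.lin 1 0) := by
        simp only [intVec]
        push_cast
        linear_combination (-((m.1 0 : ℝ) * n.1 1 - m.1 1 * n.1 0)) * hd
      have hlt : |(((m.1 0 * n.1 1 - m.1 1 * n.1 0 : ℤ) : ℝ))| < 1 := by
        rw [hdet]
        refine (abs_sub _ _).trans_lt ?_
        rw [abs_mul, abs_mul]
        have h1 := mul_le_mul hm.1 hn'.2 (abs_nonneg _) (by norm_num)
        have h2 := mul_le_mul hm.2 hn'.1 (abs_nonneg _) (by norm_num)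
        linarith
      have hz : m.1 0 * n.1 1 - m.1 1 * n.1 0 = 0 := Int.abs_lt_one_iff.1 (by exact_mod_cast hlt)
      rcases eq_or_eq_neg_of_isCoprime m.2 n.2 (sub_eq_zero.1 hz) with h | h
      · simp [Subtype.ext_iff, h]
      · simp [Subtype.ext_iff, h, m']
  · push Not at h
    have : ∀ n : PrimitiveVec,
        square (1 / 2) (intVec n ᵥ* (g.lin : Matrix (Fin 2) (Fin 2) ℝ)) = 0 :=
      fun n => square_of_lt_norm (h n)
    simp only [this, tsum_zero, zero_le]

theorem exists_eq_smul_primitiveVec (n : Fin 2 → ℤ) (hn : n ≠ 0) :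
    ∃ (d : ℕ) (k : PrimitiveVec), n = ((d + 1 : ℕ) : ℤ) • k.1 := by
  have hg : Int.gcd (n 0) (n 1) ≠ 0 := by
    intro h
    rw [Int.gcd_eq_zero_iff] at h
    apply hn
    ext i
    fin_cases i
    · exact h.1
    · exact h.2
  obtain ⟨d, hd⟩ := Nat.exists_eq_succ_of_ne_zero hg
  obtain ⟨a, ha⟩ := Int.gcd_dvd_left (n 0) (n 1)
  obtain ⟨b, hb⟩ := Int.gcd_dvd_right (n 0) (n 1)
  refine ⟨d, ⟨![a, b], ?_⟩, ?_⟩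
  · have h := Int.gcd_mul_left (Int.gcd (n 0) (n 1)) a b
    rw [← ha, ← hb, Int.natAbs_natCast] at h
    rw [Int.isCoprime_iff_gcd_eq_one]
    exact (Nat.mul_eq_left hg).1 h.symm
  · rw [hd] at ha hb
    ext i
    fin_cases i
    · exact ha
    · exact hb

theorem square_smul_natCast (d : ℕ) (x : Plane) :
    square 1 (((d + 1 : ℕ) : ℝ) • x) = square (1 / (d + 1 : ℕ)) x := by
  have hd : (0 : ℝ) < (d + 1 : ℕ) := by positivity
  have h : ‖((d + 1 : ℕ) : ℝ) • x‖ ≤ 1 ↔ ‖x‖ ≤ 1 / (d + 1 : ℕ) := by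
    rw [norm_smul, le_div_iff₀' hd, Real.norm_of_nonneg hd.le]
  exact le_antisymm (square_le_square h.1) (square_le_square h.2)

/-- The zero vector accounts for the 1, and every nonzero integer vector is `d + 1` times a
primitive one. For an upper bound it is enough that this parametrization is onto. -/
theorem shortCount_le (g : ASL) : shortCount g ≤ 1 + ∑' d : ℕ, ∑' k : PrimitiveVec,
    square (1 / (d + 1 : ℕ)) (intVec k ᵥ* (g.lin : Matrix (Fin 2) (Fin 2) ℝ)) := by
  classical
  rw [shortCount, ENNReal.tsum_eq_add_tsum_ite 0]
  refine add_le_add (square_apply_le _ _) ?_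
  let f : (Fin 2 → ℤ) → ℝ≥0∞ := fun n => if n = 0 then 0 else
    square 1 (intVec n ᵥ* (g.lin : Matrix (Fin 2) (Fin 2) ℝ))
  let q : ℕ × PrimitiveVec → Fin 2 → ℤ := fun p => ((p.1 + 1 : ℕ) : ℤ) • p.2.1
  have hsupp : ∑' n, f n = ∑' n : {n // n ≠ (0 : Fin 2 → ℤ)}, f n := by
    refine (tsum_subtype_eq_of_support_subset (s := {n | n ≠ (0 : Fin 2 → ℤ)}) ?_).symm
    intro n hn h0
    exact hn (if_pos h0)
  have hq : ∀ p, q p ≠ 0 := by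
    intro p h0
    have h1 : p.2.1 = 0 := by
      rcases smul_eq_zero.1 h0 with h | h
      · exact absurd h (by positivity)
      · exact h
    have := primitiveVec_ne_zero p.2
    rw [h1] at this
    exact this (intVec_eq_zero_iff.2 rfl)
  have hsurj : Function.Surjective fun p => (⟨q p, hq p⟩ : {n // n ≠ (0 : Fin 2 → ℤ)}) := by
    rintro ⟨n, hn⟩
    obtain ⟨d, k, h⟩ := exists_eq_smul_primitiveVec n hn
    exact ⟨(d, k), Subtype.ext h.symm⟩
  refine (tsum_congr (g := f) fun n => ?_).trans_le ?_
  · simp only [f]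
    congr
  rw [hsupp]
  refine (ENNReal.tsum_le_tsum_comp_of_surjective hsurj fun n => f n).trans ?_
  rw [ENNReal.tsum_prod']
  refine ENNReal.tsum_le_tsum fun d => ENNReal.tsum_le_tsum fun k => ?_
  have e : intVec (q (d, k)) = ((d + 1 : ℕ) : ℝ) • intVec k := by
    ext i
    simp [q, intVec]
  change f (q (d, k)) ≤ _
  rw [← square_smul_natCast, ← Matrix.smul_vecMul, ← e]
  exact (if_neg (hq _)).le

/-- Comparison with the square of radius `1/2`, which has area one and at most two primitive
vectors, bounds the mean number of primitive vectors in the square of radius `r` by `2 (2r)²`. With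
`r = 1/(d+1)` this is summable. -/
theorem IsInvariantLift.lintegral_shortCount_ne_top {P : Measure ASL} (hP : IsInvariantLift P) :
    ∫⁻ g, shortCount g ∂P ≠ ∞ := by
  have := hP.isProbabilityMeasure
  have hprim : ∀ r : ℝ, 0 ≤ r → ∫⁻ g, ∑' k : PrimitiveVec,
      square r (intVec k ᵥ* (g.lin : Matrix (Fin 2) (Fin 2) ℝ)) ∂P ≤
        2 * ENNReal.ofReal ((2 * r) ^ 2) := by
    intro r hr
    have h := hP.lintegral_tsum_mul_lintegral isPermuted_primitiveVec primitiveVec_ne_zero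
      (measurable_square r) (measurable_square (1 / 2))
    rw [lintegral_square (by norm_num), lintegral_square hr] at h
    norm_num at h
    rw [h]
    gcongr
    refine (lintegral_mono tsum_primitiveVec_le).trans ?_
    simp
  have hm : ∀ d : ℕ, Measurable fun g : ASL => ∑' k : PrimitiveVec,
      square (1 / (d + 1 : ℕ)) (intVec k ᵥ* (g.lin : Matrix (Fin 2) (Fin 2) ℝ)) :=
    fun d => measurable_tsum_lin _ (measurable_square _)
  have hsum : Summable fun d : ℕ => (2 * (1 / ((d + 1 : ℕ) : ℝ))) ^ 2 := by
    have h := ((summable_nat_add_iff 1).2 (Real.summable_one_div_nat_pow.2 one_lt_two)).mul_left 4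
    refine h.congr fun d => ?_
    ring
  refine ne_top_of_le_ne_top ?_ (lintegral_mono shortCount_le)
  rw [lintegral_add_left measurable_const, lintegral_tsum fun d => (hm d).aemeasurable]
  refine ENNReal.add_ne_top.2 ⟨by simp, ?_⟩
  refine ne_top_of_le_ne_top ?_ (ENNReal.tsum_le_tsum fun d => hprim _ (by positivity))
  rw [ENNReal.tsum_mul_left, ← ENNReal.ofReal_tsum_of_nonneg (fun d => by positivity) hsum]
  exact ENNReal.mul_ne_top (by simp) ENNReal.ofReal_ne_top

/-- Siegel's mean value formula for the nonzero vectors of `(ℤ² + c) M`. -/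
theorem IsInvariantLift.lintegral_tsum_ne_zero {P : Measure ASL} (hP : IsInvariantLift P)
    {c : Plane} (hc : IsAdmissibleShift c) {h : Plane → ℝ≥0∞} (hh : Measurable h) :
    ∫⁻ g, ∑' n : {n : Fin 2 → ℤ // intVec n + c ≠ 0},
      h ((intVec n + c) ᵥ* (g.lin : Matrix (Fin 2) (Fin 2) ℝ)) ∂P = ∫⁻ p, h p := by
  have := hP.isProbabilityMeasure
  let J := {n : Fin 2 → ℤ // intVec n + c ≠ 0}
  let a : J → Plane := fun n => intVec n + c
  have ha : IsPermuted a := by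
    intro γ hγ
    obtain ⟨e, he⟩ := hc γ hγ
    refine ⟨e.subtypePerm fun n => ?_, fun n => he n⟩
    rw [← he, Ne, vecMul_eq_zero_iff]
  have hprop := fun {h w : Plane → ℝ≥0∞} (hh : Measurable h) (hw : Measurable w) =>
    hP.lintegral_tsum_mul_lintegral ha (fun n => n.2) hh hw
  let E : ℝ → ℝ≥0∞ := fun r => ∫⁻ g, ∑' n, square r (a n ᵥ*
    (g.lin : Matrix (Fin 2) (Fin 2) ℝ)) ∂P
  have hshift : ∀ (g : ASL) (n : Fin 2 → ℤ),
      (intVec n + c) ᵥ* (g.lin : Matrix (Fin 2) (Fin 2) ℝ) =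
      c ᵥ* (g.lin : Matrix (Fin 2) (Fin 2) ℝ) + intVec n ᵥ* (g.lin : Matrix (Fin 2) (Fin 2) ℝ) :=
    fun g n => by rw [Matrix.add_vecMul, add_comm]
  -- By proportionality the mean count divided by the area does not depend on the square; radius
  -- `1/2` is the reference of area one.
  have hE : ∀ R : ℕ, E (R + 1 : ℕ) / ENNReal.ofReal ((2 * (R + 1 : ℕ)) ^ 2) = E (1 / 2) := by
    intro R
    have h1 := hprop (measurable_square (R + 1 : ℕ)) (measurable_square (1 / 2))
    rw [lintegral_square (by norm_num), lintegral_square (Nat.cast_nonneg _)] at h1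
    norm_num only [one_div, mul_inv_cancel₀, one_pow, ENNReal.ofReal_one, mul_one] at h1
    have hpos : (0 : ℝ) < (2 * (R + 1 : ℕ)) ^ 2 := by positivity
    have h2 : E (R + 1 : ℕ) = E (1 / 2) * ENNReal.ofReal ((2 * (R + 1 : ℕ)) ^ 2) := h1
    rw [h2, ENNReal.mul_div_cancel_right (ENNReal.ofReal_pos.2 hpos).ne' ENNReal.ofReal_ne_top]
  have hlim : Tendsto (fun R : ℕ => E (R + 1 : ℕ) / ENNReal.ofReal ((2 * (R + 1 : ℕ)) ^ 2))
      atTop (𝓝 1) := by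
    let F : ℕ → ASL → ℝ≥0∞ := fun R g => (∑' n, square (R + 1 : ℕ) (a n ᵥ*
      (g.lin : Matrix (Fin 2) (Fin 2) ℝ))) / ENNReal.ofReal ((2 * (R + 1 : ℕ)) ^ 2)
    have hm : ∀ R : ℕ, Measurable fun g : ASL => ∑' n, square (R + 1 : ℕ) (a n ᵥ*
        (g.lin : Matrix (Fin 2) (Fin 2) ℝ)) := fun R => measurable_tsum_lin a (measurable_square _)
    have hle : ∀ (r : ℝ) (g : ASL), ∑' n, square r (a n ᵥ*
        (g.lin : Matrix (Fin 2) (Fin 2) ℝ)) ≤ ∑' n : Fin 2 → ℤ, square r (c ᵥ*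
          (g.lin : Matrix (Fin 2) (Fin 2) ℝ) + intVec n ᵥ*
            (g.lin : Matrix (Fin 2) (Fin 2) ℝ)) := by
      intro r g
      simp only [← hshift]
      exact ENNReal.tsum_comp_le_tsum_of_injective Subtype.val_injective fun n : Fin 2 → ℤ =>
        square r ((intVec n + c) ᵥ* (g.lin : Matrix (Fin 2) (Fin 2) ℝ))
    have hge : ∀ (r : ℝ) (g : ASL), ∑' n : Fin 2 → ℤ, square r (c ᵥ*
          (g.lin : Matrix (Fin 2) (Fin 2) ℝ) + intVec n ᵥ*
            (g.lin : Matrix (Fin 2) (Fin 2) ℝ)) ≤ ∑' n, square r (a n ᵥ*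
        (g.lin : Matrix (Fin 2) (Fin 2) ℝ)) + 1 := by
      classical
      intro r g
      simp only [← hshift]
      let f : (Fin 2 → ℤ) → ℝ≥0∞ := fun n =>
        square r ((intVec n + c) ᵥ* (g.lin : Matrix (Fin 2) (Fin 2) ℝ))
      have h1 := ENNReal.summable.tsum_add_tsum_compl
        (f := f) (s := {n : Fin 2 → ℤ | intVec n + c ≠ 0}) ENNReal.summable
      change ∑' n, f n ≤ _
      rw [← h1]
      refine add_le_add le_rfl ?_
      -- At most one `n` has `intVec n + c = 0`, so leaving it out changes the count by at most one,
      -- which is negligible against the area.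
      have hsub : Subsingleton ({n : Fin 2 → ℤ | intVec n + c ≠ 0}ᶜ : Set (Fin 2 → ℤ)) := by
        constructor
        rintro ⟨m, hm⟩ ⟨n, hn⟩
        simp only [Set.mem_compl_iff, Set.mem_ofPred_eq, not_not] at hm hn
        exact Subtype.ext (intVec_injective (add_right_cancel (hm.trans hn.symm)))
      rcases isEmpty_or_nonempty ({n : Fin 2 → ℤ | intVec n + c ≠ 0}ᶜ : Set (Fin 2 → ℤ)) with
        hemp | ⟨⟨n⟩⟩
      · simp
      · rw [tsum_eq_single n fun m hm => absurd (Subsingleton.elim m n) hm]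
        exact square_apply_le _ _
    have hF : Tendsto (fun R => ∫⁻ g, F R g ∂P) atTop (𝓝 (∫⁻ _, 1 ∂P)) := by
      refine tendsto_lintegral_of_dominated_convergence (fun g => 4 * shortCount g)
        (fun R => (hm R).div_const _) (fun R => Eventually.of_forall fun g => ?_) ?_
        (Eventually.of_forall fun g => ?_)
      · exact (ENNReal.div_le_div_right (hle _ g) _).trans (tsum_square_div_le _ g R)
      · rw [lintegral_const_mul _ measurable_shortCount]
        exact ENNReal.mul_ne_top (by simp) hP.lintegral_shortCount_ne_top
      · have ht := tendsto_tsum_square_div (c ᵥ* (g.lin : Matrix (Fin 2) (Fin 2) ℝ)) g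
        have hv : Tendsto (fun R : ℕ => 1 / ENNReal.ofReal ((2 * (R + 1 : ℕ)) ^ 2)) atTop
            (𝓝 0) := by
          simp only [one_div]
          rw [← tendsto_inv_iff]
          simp only [inv_inv, ENNReal.inv_zero]
          refine ENNReal.tendsto_ofReal_atTop.comp ?_
          refine (tendsto_pow_atTop two_ne_zero).comp ?_
          exact (tendsto_natCast_atTop_atTop.comp (tendsto_add_atTop_nat 1)).const_mul_atTop
            two_pos
        have hsub := ENNReal.Tendsto.sub ht hv (Or.inl (by simp))
        rw [tsub_zero] at hsub
        refine tendsto_of_tendsto_of_tendsto_of_le_of_le hsub ht (fun R => ?_) fun R => ?_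
        · change _ - _ ≤ _
          rw [tsub_le_iff_right, ← ENNReal.add_div]
          exact ENNReal.div_le_div_right (hge _ g) _
        · exact ENNReal.div_le_div_right (hle _ g) _
    rw [lintegral_one, measure_univ] at hF
    refine hF.congr fun R => ?_
    simp only [F, div_eq_mul_inv]
    rw [lintegral_mul_const _ (hm R)]
  simp only [hE] at hlim
  have h1 : E (1 / 2) = 1 := tendsto_nhds_unique tendsto_const_nhds hlim
  have h2 := hprop hh (measurable_square (1 / 2))
  change _ = E (1 / 2) * _ at h2
  rw [h1, lintegral_square (by norm_num), one_mul] at h2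
  norm_num at h2
  exact h2

/-! ### Averaging over translations, and the formula for pairs. -/

/-- Averaging over translations: for a random family of marked points `(X j, Z j)` that is
equivariant under translations, the positions are uniformly distributed given the marks. -/
theorem IsInvariantLift.lintegral_tsum_translation {P : Measure ASL} (hP : IsInvariantLift P)
    {J β : Type*} [Countable J] [MeasurableSpace β] {X : J → ASL → Plane} {Z : J → ASL → β}
    (hX : ∀ j, Measurable (X j)) (hZ : ∀ j, Measurable (Z j))
    (hXt : ∀ j g ξ, X j (g * ASL.translation ξ) = X j g + ξ)
    (hZt : ∀ j g ξ, Z j (g * ASL.translation ξ) = Z j g)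
    (hperm : ∀ γ ∈ Lam, ∃ e : Equiv.Perm J, ∀ j g, X j (γ * g) = X (e j) g ∧
      Z j (γ * g) = Z (e j) g)
    {F : Plane × β → ℝ≥0∞} (hF : Measurable F) {u : Plane → ℝ≥0∞} (hu : Measurable u) :
    (∫⁻ g, ∑' j, F (X j g, Z j g) ∂P) * ∫⁻ x, u x =
      ∫⁻ g, (∑' j, u (X j g) * ∫⁻ ξ, F (ξ, Z j g)) ∂P := by
  have := hP.isProbabilityMeasure
  have hmF : ∀ j, Measurable fun g => F (X j g, Z j g) := fun j =>
    hF.comp ((hX j).prodMk (hZ j))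
  have hm1 : ∀ j, Measurable fun q : Plane × ASL => u (X j q.2) * F (X j q.2 + q.1, Z j q.2) :=
    fun j => (hu.comp ((hX j).comp measurable_snd)).mul <| hF.comp <|
      (((hX j).comp measurable_snd).add measurable_fst).prodMk ((hZ j).comp measurable_snd)
  have hm2 : ∀ j, Measurable fun q : Plane × ASL => u (X j q.2 - q.1) * F (X j q.2, Z j q.2) :=
    fun j => (hu.comp (((hX j).comp measurable_snd).sub measurable_fst)).mul
      ((hmF j).comp measurable_snd)
  -- Invariance under translation by `-ξ` moves the shift from the argument of `F` to the argument
  -- of `u`.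
  have hinv : ∀ ξ, ∫⁻ g, ∑' j, u (X j g) * F (X j g + ξ, Z j g) ∂P =
      ∫⁻ g, ∑' j, u (X j g - ξ) * F (X j g, Z j g) ∂P := by
    intro ξ
    rw [← hP.lintegral_mul (fun g => ∑' j, u (X j g) * F (X j g + ξ, Z j g))
      (Measurable.tsum fun j => (hm1 j).comp (measurable_const.prodMk measurable_id)) ?_
      (ASL.translation (-ξ))]
    · simp only [hXt, hZt, ← sub_eq_add_neg, sub_add_cancel]
    · intro γ hγ g
      obtain ⟨e, he⟩ := hperm γ hγ
      simp only [fun j => (he j g).1, fun j => (he j g).2]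
      exact e.tsum_eq fun j => u (X j g) * F (X j g + ξ, Z j g)
  -- For each `j`, the factor `∫ u` is written as `∫ u (X j g - ξ) dξ`. After exchanging integrals
  -- and moving `ξ` over to `F`, the integral over `ξ` removes the position from `F`.
  calc (∫⁻ g, ∑' j, F (X j g, Z j g) ∂P) * ∫⁻ x, u x
      = ∫⁻ g, ((∑' j, F (X j g, Z j g)) * ∫⁻ x, u x) ∂P :=
        (lintegral_mul_const _ (Measurable.tsum hmF)).symm
    _ = ∫⁻ g, (∫⁻ ξ, ∑' j, u (X j g - ξ) * F (X j g, Z j g)) ∂P := by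
        congr 1 with g
        rw [lintegral_tsum (f := fun j ξ => u (X j g - ξ) * F (X j g, Z j g)) fun j =>
          ((hm2 j).comp (measurable_id.prodMk measurable_const)).aemeasurable,
          ← ENNReal.tsum_mul_right]
        congr 1 with j
        rw [lintegral_mul_const (f := fun ξ => u (X j g - ξ)) _
            (hu.comp (measurable_const.sub measurable_id)),
          lintegral_sub_left_eq_self u, mul_comm]
    _ = ∫⁻ ξ, ∫⁻ g, ∑' j, u (X j g - ξ) * F (X j g, Z j g) ∂P :=
        (lintegral_lintegral_swap (Measurable.aemeasurable (Measurable.tsum hm2))).symm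
    _ = ∫⁻ ξ, ∫⁻ g, ∑' j, u (X j g) * F (X j g + ξ, Z j g) ∂P := by simp only [hinv]
    _ = ∫⁻ g, (∫⁻ ξ, ∑' j, u (X j g) * F (X j g + ξ, Z j g)) ∂P :=
        lintegral_lintegral_swap (Measurable.aemeasurable (Measurable.tsum hm1))
    _ = _ := by
        congr 1 with g
        rw [lintegral_tsum (f := fun j ξ => u (X j g) * F (X j g + ξ, Z j g)) fun j =>
          ((hm1 j).comp (measurable_id.prodMk measurable_const)).aemeasurable]
        congr 1 with j
        rw [lintegral_const_mul (f := fun ξ => F (X j g + ξ, Z j g)) _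
          (hF.comp ((measurable_const.add measurable_id).prodMk measurable_const)),
        lintegral_add_left_eq_self fun ξ => F (ξ, Z j g)]

/-- `H` depends on the lattice `ℤ² M` only: it is invariant under `Λ` and under translations. -/
structure IsLatticeFunction (H : ASL → ℝ≥0∞) : Prop where
  measurable : Measurable H
  mul_left : ∀ γ ∈ Lam, ∀ g, H (γ * g) = H g
  mul_translation : ∀ g ξ, H (g * ASL.translation ξ) = H g

theorem IsPermuted.isLatticeFunction {J : Type*} [Countable J] {a : J → Plane}
    (ha : IsPermuted a) {h : Plane → ℝ≥0∞} (hh : Measurable h) :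
    IsLatticeFunction fun g => ∑' j, h (a j ᵥ* (g.lin : Matrix (Fin 2) (Fin 2) ℝ)) :=
  ⟨measurable_tsum_lin a hh, fun _ hγ g => ha.tsum_mul h hγ g, fun g ξ => by
    simp only [ASL.mul_translation_lin]⟩

theorem isPermuted_intVec : IsPermuted intVec := by
  intro γ hγ
  obtain ⟨e, he⟩ := isAdmissibleShift_sub (Or.inl rfl) (Or.inl rfl) γ hγ
  exact ⟨e, fun n => by simpa using he n⟩

theorem isLatticeFunction_shortCount : IsLatticeFunction shortCount :=
  isPermuted_intVec.isLatticeFunction (measurable_square 1)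

theorem ASL.act_mul_translation (x : Plane) (g : ASL) (ξ : Plane) :
    act x (g * translation ξ) = act x g + ξ := by
  rw [act_mul, act_translation]

/-- Independence of the points of `(ℤ² + v) g` from the lattice, up to the normalization. -/
theorem IsInvariantLift.lintegral_mul_tsum_act_mul {P : Measure ASL} (hP : IsInvariantLift P)
    {v : Plane} (hv : v = 0 ∨ v = shiftVec) {H : ASL → ℝ≥0∞} (hH : IsLatticeFunction H)
    {u w : Plane → ℝ≥0∞} (hu : Measurable u) (hw : Measurable w) :
    (∫⁻ g, H g * ∑' m, u (ASL.act (intVec m + v) g) ∂P) * ∫⁻ x, w x =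
      (∫⁻ g, H g * ∑' m, w (ASL.act (intVec m + v) g) ∂P) * ∫⁻ x, u x := by
  have h := hP.lintegral_tsum_translation (X := fun m g => ASL.act (intVec m + v) g)
    (Z := fun _ g => H g) (fun m => ASL.measurable_act _) (fun _ => hH.measurable)
    (fun m g ξ => ASL.act_mul_translation _ g ξ) (fun _ g ξ => hH.mul_translation g ξ)
    (fun γ hγ => by
      obtain ⟨e, he⟩ := exists_perm_act hγ hv
      exact ⟨e, fun m g => ⟨by rw [ASL.act_mul, he], hH.mul_left γ hγ g⟩⟩)
    (F := fun q => q.2 * u q.1) (measurable_snd.mul (hu.comp measurable_fst)) hw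
  simp only [ENNReal.tsum_mul_left] at h
  rw [h, ← lintegral_mul_const]
  · congr 1 with g
    rw [lintegral_const_mul _ hu, ENNReal.tsum_mul_right]
    ring
  · exact hH.measurable.mul (Measurable.tsum fun m => hw.comp (ASL.measurable_act _))

theorem act_intVec_add (m : Fin 2 → ℤ) (v : Plane) (g : ASL) :
    ASL.act (intVec m + v) g = ASL.act v g + intVec m ᵥ* (g.lin : Matrix (Fin 2) (Fin 2) ℝ) := by
  rw [ASL.act, ASL.act, Matrix.add_vecMul]
  abel

/-- The `H`-weighted mean count per area is the same for all squares and tends to `∫ H`. The bound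
on `H * shortCount` supplies a constant dominating function. -/
theorem IsInvariantLift.lintegral_mul_tsum_act_of_le {P : Measure ASL} (hP : IsInvariantLift P)
    {v : Plane} (hv : v = 0 ∨ v = shiftVec) {H : ASL → ℝ≥0∞} (hH : IsLatticeFunction H) {C : ℝ≥0∞}
    (hC : C ≠ ∞) (hHC : ∀ g, H g * shortCount g ≤ C) :
    ∫⁻ g, H g * ∑' m, square (1 / 2) (ASL.act (intVec m + v) g) ∂P = ∫⁻ g, H g ∂P := by
  have := hP.isProbabilityMeasure
  let V : ℕ → ℝ≥0∞ := fun R => ENNReal.ofReal ((2 * (R + 1 : ℕ)) ^ 2)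
  have hm : ∀ r : ℝ, Measurable fun g => ∑' m, square r (ASL.act (intVec m + v) g) := fun r =>
    Measurable.tsum fun m => (measurable_square r).comp (ASL.measurable_act _)
  let F : ℕ → ASL → ℝ≥0∞ := fun R g =>
    H g * ((∑' m, square (R + 1 : ℕ) (ASL.act (intVec m + v) g)) / V R)
  have hF : ∀ R, ∫⁻ g, F R g ∂P =
      ∫⁻ g, H g * ∑' m, square (1 / 2) (ASL.act (intVec m + v) g) ∂P := by
    intro R
    have h := hP.lintegral_mul_tsum_act_mul hv hH (measurable_square (R + 1 : ℕ))
      (measurable_square (1 / 2))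
    rw [lintegral_square (by norm_num), lintegral_square (Nat.cast_nonneg _)] at h
    norm_num only [one_div, mul_inv_cancel₀, one_pow, ENNReal.ofReal_one, mul_one] at h
    have hpos : (0 : ℝ) < (2 * (R + 1 : ℕ)) ^ 2 := by positivity
    simp only [F, ← mul_div_assoc]
    simp only [div_eq_mul_inv (_ * _)]
    rw [lintegral_mul_const (f := fun g => H g *
      ∑' m, square (R + 1 : ℕ) (ASL.act (intVec m + v) g)) _ (hH.measurable.mul (hm _)), h, mul_assoc,
      ENNReal.mul_inv_cancel
      (ENNReal.ofReal_pos.2 hpos).ne' ENNReal.ofReal_ne_top, mul_one]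
  have hlim : Tendsto (fun R => ∫⁻ g, F R g ∂P) atTop (𝓝 (∫⁻ g, H g ∂P)) := by
    refine tendsto_lintegral_of_dominated_convergence (fun _ => 4 * C)
      (fun R => hH.measurable.mul ((hm _).div_const _)) (fun R => Eventually.of_forall fun g => ?_)
      ?_ (Eventually.of_forall fun g => ?_)
    · simp only [F, act_intVec_add]
      refine (mul_le_mul_right (tsum_square_div_le _ g R) _).trans ?_
      rw [mul_left_comm]
      exact mul_le_mul_right (hHC g) _
    · rw [lintegral_const, measure_univ, mul_one]
      exact ENNReal.mul_ne_top (by simp) hC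
    · have ht := tendsto_tsum_square_div (ASL.act v g) g
      simp only [F, act_intVec_add]
      have := ENNReal.Tendsto.const_mul (a := H g) ht (Or.inl one_ne_zero)
      rwa [mul_one] at this
  simp only [hF] at hlim
  exact tendsto_nhds_unique tendsto_const_nhds hlim

/-- Given the lattice, the points of `(ℤ² + v) g` are uniformly distributed with density one. -/
theorem IsInvariantLift.lintegral_mul_tsum_act {P : Measure ASL} (hP : IsInvariantLift P)
    {v : Plane} (hv : v = 0 ∨ v = shiftVec) {H : ASL → ℝ≥0∞} (hH : IsLatticeFunction H)
    {u : Plane → ℝ≥0∞} (hu : Measurable u) :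
    ∫⁻ g, H g * ∑' m, u (ASL.act (intVec m + v) g) ∂P = (∫⁻ g, H g ∂P) * ∫⁻ x, u x := by
  have := hP.isProbabilityMeasure
  suffices h1 : ∫⁻ g, H g * ∑' m, square (1 / 2) (ASL.act (intVec m + v) g) ∂P = ∫⁻ g, H g ∂P by
    have h := hP.lintegral_mul_tsum_act_mul hv hH hu (measurable_square (1 / 2))
    rw [lintegral_square (by norm_num), h1] at h
    norm_num at h
    exact h
  have hm : ∀ r : ℝ, Measurable fun g => ∑' m, square r (ASL.act (intVec m + v) g) := fun r =>
    Measurable.tsum fun m => (measurable_square r).comp (ASL.measurable_act _)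
  -- Truncating both `H` and `shortCount` at `n` bounds `T n * shortCount` by `n²` and keeps a
  -- lattice function; monotone convergence then removes the truncation.
  let T : ℕ → ASL → ℝ≥0∞ := fun n g => {g | shortCount g ≤ n}.indicator (fun g => min (H g) n) g
  have hS : ∀ n : ℕ, MeasurableSet {g | shortCount g ≤ n} := fun n =>
    measurableSet_le measurable_shortCount measurable_const
  have hTm : ∀ n, Measurable (T n) := fun n =>
    (hH.measurable.min measurable_const).indicator (hS n)
  have hT : ∀ n, IsLatticeFunction (T n) := by
    intro n
    refine ⟨hTm n, fun γ hγ g => ?_, fun g ξ => ?_⟩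
    · simp only [T, Set.indicator, Set.mem_ofPred_eq, hH.mul_left γ hγ,
        isLatticeFunction_shortCount.mul_left γ hγ]
    · simp only [T, Set.indicator, Set.mem_ofPred_eq, hH.mul_translation,
        isLatticeFunction_shortCount.mul_translation]
  have hTb : ∀ (n : ℕ) g, T n g * shortCount g ≤ (n : ℝ≥0∞) * n := by
    intro n g
    simp only [T, Set.indicator, Set.mem_ofPred_eq]
    split_ifs with h
    · exact mul_le_mul' (min_le_right _ _) h
    · simp
  have hTe := fun n => hP.lintegral_mul_tsum_act_of_le hv (hT n)
    (ENNReal.mul_ne_top (ENNReal.natCast_ne_top n) (ENNReal.natCast_ne_top n)) (hTb n)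
  have hmono : ∀ g, Monotone fun n => T n g := by
    intro g m n hmn
    have hmn' : (m : ℝ≥0∞) ≤ n := by exact_mod_cast hmn
    simp only [T, Set.indicator, Set.mem_ofPred_eq]
    split_ifs with h1 h2
    · exact min_le_min_left _ hmn'
    · exact absurd (h1.trans hmn') h2
    · exact zero_le
    · exact le_rfl
  have hfin : ∀ᵐ g ∂P, shortCount g < ∞ :=
    ae_lt_top measurable_shortCount hP.lintegral_shortCount_ne_top
  have hlim : ∀ g, shortCount g < ∞ → Tendsto (fun n => T n g) atTop (𝓝 (H g)) := by
    intro g hg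
    obtain ⟨N, hN⟩ := ENNReal.exists_nat_gt hg.ne
    have h1 : Tendsto (fun n : ℕ => min (H g) (n : ℝ≥0∞)) atTop (𝓝 (min (H g) ∞)) :=
      tendsto_const_nhds.min ENNReal.tendsto_nat_nhds_top
    rw [min_eq_left le_top] at h1
    refine h1.congr' ?_
    filter_upwards [eventually_ge_atTop N] with n hn
    have hNn : (N : ℝ≥0∞) ≤ n := by exact_mod_cast hn
    simp only [T, Set.indicator, Set.mem_ofPred_eq, if_pos (hN.le.trans hNn)]
  have hl1 : Tendsto (fun n => ∫⁻ g, T n g ∂P) atTop (𝓝 (∫⁻ g, H g ∂P)) :=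
    lintegral_tendsto_of_tendsto_of_monotone (fun n => (hTm n).aemeasurable)
      (Eventually.of_forall hmono) (hfin.mono hlim)
  have hl2 : Tendsto (fun n => ∫⁻ g, T n g *
      ∑' m, square (1 / 2) (ASL.act (intVec m + v) g) ∂P) atTop
      (𝓝 (∫⁻ g, H g * ∑' m, square (1 / 2) (ASL.act (intVec m + v) g) ∂P)) := by
    refine lintegral_tendsto_of_tendsto_of_monotone
      (fun n => ((hTm n).mul (hm _)).aemeasurable)
      (Eventually.of_forall fun g m n hmn => mul_le_mul_left (hmono g hmn) _)
      (hfin.mono fun g hg => ENNReal.Tendsto.mul_const (hlim g hg) (Or.inr ?_))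
    -- Multiplication by the count passes to the limit because the count is finite wherever
    -- `shortCount` is.
    have h1 : ∑' m, square (1 / 2) (ASL.act (intVec m + v) g) ≤
        (2 * (1 : ℕ) + 1) ^ 2 * shortCount g := by
      refine le_trans (ENNReal.tsum_le_tsum fun m => ?_) (tsum_square_le (ASL.act v g) g 1)
      rw [act_intVec_add]
      refine square_le_square fun h => h.trans ?_
      norm_num
    refine ne_top_of_le_ne_top (ENNReal.mul_ne_top ?_ hg.ne) h1
    finiteness
  simp only [hTe] at hl2
  exact tendsto_nhds_unique hl2 hl1

/-- The mean value formula for ordered pairs of distinct points of `(ℤ² + v) g` and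
`(ℤ² + w) g`. -/
theorem IsInvariantLift.lintegral_tsum_pairs {P : Measure ASL} (hP : IsInvariantLift P)
    {v w : Plane} (hv : v = 0 ∨ v = shiftVec) (hw : w = 0 ∨ w = shiftVec)
    {F : Plane × Plane → ℝ≥0∞} (hF : Measurable F) :
    ∫⁻ g, ∑' p : {p : (Fin 2 → ℤ) × (Fin 2 → ℤ) // intVec p.1 + v ≠ intVec p.2 + w},
      F (ASL.act (intVec p.1.1 + v) g, ASL.act (intVec p.1.2 + w) g) ∂P = ∫⁻ q, F q := by
  -- The nonzero difference vectors: for `v = w` only the diagonal is removed.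
  let K := {n : Fin 2 → ℤ // intVec n + (w - v) ≠ 0}
  let X : (Fin 2 → ℤ) × K → ASL → Plane := fun j g => ASL.act (intVec j.1 + v) g
  let a : K → Plane := fun n => intVec n + (w - v)
  let Z : (Fin 2 → ℤ) × K → ASL → Plane := fun j g =>
    a j.2 ᵥ* (g.lin : Matrix (Fin 2) (Fin 2) ℝ)
  have hc := isAdmissibleShift_sub hv hw
  have ha : IsPermuted a := by
    intro γ hγ
    obtain ⟨e, he⟩ := hc γ hγ
    refine ⟨e.subtypePerm fun n => ?_, fun n => he n⟩
    rw [← he, Ne, vecMul_eq_zero_iff]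
  have hdiff : ∀ m n : Fin 2 → ℤ,
      intVec (n - m) + (w - v) = (intVec n + w) - (intVec m + v) := by
    intro m n
    rw [intVec_sub]
    abel
  let e : {p : (Fin 2 → ℤ) × (Fin 2 → ℤ) // intVec p.1 + v ≠ intVec p.2 + w} ≃
      (Fin 2 → ℤ) × K :=
    { toFun := fun p => (p.1.1, ⟨p.1.2 - p.1.1, by
        rw [hdiff, sub_ne_zero]
        exact p.2.symm⟩)
      invFun := fun j => ⟨(j.1, j.2.1 + j.1), by
        have h := j.2.2
        rw [← add_sub_cancel_right j.2.1 j.1, hdiff, sub_ne_zero] at h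
        exact h.symm⟩
      left_inv := fun p => by simp
      right_inv := fun j => by simp }
  let F' : Plane × Plane → ℝ≥0∞ := fun q => F (q.1, q.1 + q.2)
  have hF' : Measurable F' := hF.comp (measurable_fst.prodMk (measurable_fst.add measurable_snd))
  have h1 : ∀ g, ∑' p : {p : (Fin 2 → ℤ) × (Fin 2 → ℤ) // intVec p.1 + v ≠ intVec p.2 + w},
      F (ASL.act (intVec p.1.1 + v) g, ASL.act (intVec p.1.2 + w) g) =
        ∑' j, F' (X j g, Z j g) := by
    intro g
    rw [← e.tsum_eq]
    congr 1 with p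
    simp only [F', X, Z, a, e, Equiv.coe_fn_mk]
    rw [hdiff, ← ASL.act_sub_act, add_sub_cancel]
  -- The first point is the position and the difference vector the mark, which translations do not
  -- change.
  have h2 := hP.lintegral_tsum_translation (X := X) (Z := Z) (fun j => ASL.measurable_act _)
    (fun j => measurable_vecMul_lin _) (fun j g ξ => ASL.act_mul_translation _ g ξ)
    (fun j g ξ => by simp only [Z, ASL.mul_translation_lin])
    (fun γ hγ => by
      obtain ⟨e₁, he₁⟩ := exists_perm_act hγ hv
      obtain ⟨e₂, he₂⟩ := ha γ hγ
      refine ⟨e₁.prodCongr e₂, fun j g => ⟨?_, ?_⟩⟩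
      · simp only [X, ASL.act_mul, he₁]
        rfl
      · simp only [Z, vecMul_mul_lin, he₂]
        rfl) hF' (measurable_square (1 / 2))
  rw [lintegral_square (by norm_num)] at h2
  norm_num only [one_div, mul_inv_cancel₀, one_pow, ENNReal.ofReal_one, mul_one] at h2
  let h : Plane → ℝ≥0∞ := fun z => ∫⁻ ξ, F' (ξ, z)
  have hh : Measurable h := hF'.lintegral_prod_left'
  simp only [h1]
  rw [h2]
  have h3 : ∀ g, ∑' j, square (1 / 2) (X j g) * ∫⁻ ξ, F' (ξ, Z j g) =
      (∑' k, h (a k ᵥ* (g.lin : Matrix (Fin 2) (Fin 2) ℝ))) *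
        ∑' m, square (1 / 2) (ASL.act (intVec m + v) g) := by
    intro g
    rw [ENNReal.tsum_prod', ← ENNReal.tsum_mul_left]
    congr 1 with m
    rw [mul_comm, ← ENNReal.tsum_mul_left]
  simp only [h3]
  -- The sum of `h` over the difference vectors depends on the lattice only, so it decouples from
  -- the first point; its mean is `∫ h`.
  have h4 := hP.lintegral_mul_tsum_act hv (ha.isLatticeFunction hh) (measurable_square (1 / 2))
  rw [lintegral_square (by norm_num), hP.lintegral_tsum_ne_zero hc hh] at h4
  norm_num at h4
  rw [h4, Measure.volume_eq_prod, lintegral_prod _ hF.aemeasurable,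
    lintegral_lintegral_swap (f := fun z ξ => F' (ξ, z)) (hF'.comp measurable_swap).aemeasurable]
  congr 1 with ξ
  exact lintegral_add_left_eq_self (fun z => F (ξ, z)) ξ

/-! ### From a biinvariant measure of finite covolume to `μ`. -/

/-- `η` is invariant under left multiplication by `Λ` and under right multiplication. -/
structure IsBiinvariant (η : Measure ASL) : Prop where
  mul_left : ∀ γ ∈ Lam, MeasurePreserving (fun g => γ * g) η η
  mul_right : ∀ h : ASL, MeasurePreserving (fun g => g * h) η η

/-- A set that meets every coset `Λ g` at most once is not larger than a set that meets every
coset at least once. -/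
theorem IsBiinvariant.measure_inter_le {η : Measure ASL} (hη : IsBiinvariant η) {D S E : Set ASL}
    (hD : MeasurableSet D) (hS : MeasurableSet S) (hE : MeasurableSet E)
    (hDu : ∀ g, ∀ γ δ : Lam, (γ : ASL) * g ∈ D → (δ : ASL) * g ∈ D → γ = δ)
    (hSc : ∀ g, ∃ γ : Lam, (γ : ASL) * g ∈ S)
    (hEi : ∀ γ : Lam, ∀ g, (γ : ASL) * g ∈ E ↔ g ∈ E) : η (D ∩ E) ≤ η (S ∩ E) := by
  -- `T γ` is the translate `γ D`. The pieces of `D ∩ E` that `γ` carries into `S` land in `T γ ∩ (S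
  -- ∩ E)`, and these are disjoint since `D` meets each coset at most once.
  let T : Lam → Set ASL := fun γ => (fun g => ((γ⁻¹ : Lam) : ASL) * g) ⁻¹' D
  have hT : ∀ γ, MeasurableSet (T γ) := fun γ => ASL.measurable_mul_left _ hD
  have hsub : D ∩ E ⊆ ⋃ γ : Lam, (fun g => (γ : ASL) * g) ⁻¹' (T γ ∩ (S ∩ E)) := by
    rintro g ⟨hgD, hgE⟩
    obtain ⟨γ, hγ⟩ := hSc g
    refine Set.mem_iUnion.2 ⟨γ, ?_, hγ, (hEi γ g).2 hgE⟩
    change ((γ⁻¹ : Lam) : ASL) * ((γ : ASL) * g) ∈ D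
    simpa using hgD
  have hdisj : Pairwise (Function.onFun Disjoint fun γ => T γ ∩ (S ∩ E)) := by
    intro γ δ hne
    refine Set.disjoint_left.2 fun g h1 h2 => hne ?_
    exact inv_injective (hDu g _ _ h1.1 h2.1)
  calc η (D ∩ E) ≤ η (⋃ γ : Lam, (fun g => (γ : ASL) * g) ⁻¹' (T γ ∩ (S ∩ E))) :=
        measure_mono hsub
    _ ≤ ∑' γ : Lam, η ((fun g => (γ : ASL) * g) ⁻¹' (T γ ∩ (S ∩ E))) := measure_iUnion_le _
    _ = ∑' γ : Lam, η (T γ ∩ (S ∩ E)) := by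
        congr 1 with γ
        exact (hη.mul_left γ γ.2).measure_preimage
          ((hT γ).inter (hS.inter hE)).nullMeasurableSet
    _ = η (⋃ γ : Lam, T γ ∩ (S ∩ E)) :=
        (measure_iUnion hdisj fun γ => (hT γ).inter (hS.inter hE)).symm
    _ ≤ η (S ∩ E) := measure_mono (Set.iUnion_subset fun γ => Set.inter_subset_right)

/-- A biinvariant measure of finite covolume induces an invariant probability measure on `Y`. -/
theorem IsBiinvariant.exists_isInvariantProbability {η : Measure ASL} (hη : IsBiinvariant η)
    (h0 : η ≠ 0) {S : Set ASL} (hS : MeasurableSet S) (hSc : ∀ g, ∃ γ : Lam, (γ : ASL) * g ∈ S)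
    (hSfin : η S ≠ ∞) : ∃ μ : Measure YSpace, IsInvariantProbability μ := by
  obtain ⟨D, hD, hex⟩ := exists_strict_fundamentalDomain
  have hDu : ∀ g, ∀ γ δ : Lam, (γ : ASL) * g ∈ D → (δ : ASL) * g ∈ D → γ = δ :=
    fun g _ _ h1 h2 => (hex g).unique h1 h2
  have hDc : ∀ g, ∃ γ : Lam, (γ : ASL) * g ∈ D := fun g => (hex g).exists
  have hfin : η D ≠ ∞ := by
    have := hη.measure_inter_le hD hS MeasurableSet.univ hDu hSc (by simp)
    simp only [Set.inter_univ] at this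
    exact ne_top_of_le_ne_top hSfin this
  have hpos : η D ≠ 0 := by
    intro hz
    apply h0
    rw [← Measure.measure_univ_eq_zero]
    have : (Set.univ : Set ASL) = ⋃ γ : Lam, (fun g => (γ : ASL) * g) ⁻¹' D := by
      ext g
      simpa using hex g |>.exists
    rw [this, measure_iUnion_null_iff]
    intro γ
    rw [(hη.mul_left γ γ.2).measure_preimage hD.nullMeasurableSet, hz]
  refine ⟨(η D)⁻¹ • (η.restrict D).map toY, ⟨⟨?_⟩, fun h => ?_⟩⟩
  · rw [Measure.smul_apply, Measure.map_apply measurable_toY MeasurableSet.univ,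
      Set.preimage_univ, Measure.restrict_apply_univ, smul_eq_mul, ENNReal.inv_mul_cancel hpos hfin]
  · have hm : Measurable (rightTranslate h) :=
      measurable_from_quotient.2 (measurable_toY.comp (ASL.measurable_mul_right h))
    refine MeasurePreserving.smul_measure ⟨hm, ?_⟩ _
    ext B hB
    have hE : MeasurableSet (toY ⁻¹' B) := measurable_toY hB
    rw [Measure.map_apply hm hB, Measure.map_apply measurable_toY (hm hB),
      Measure.map_apply measurable_toY hB, Measure.restrict_apply (measurable_toY (hm hB)),
      Measure.restrict_apply hE]
    -- `D' = D h` is again a fundamental domain, so invariance on `Y` reduces to comparing `D` and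
    -- `D'` within a `Λ`-invariant set.
    let D' : Set ASL := (fun g => g * h⁻¹) ⁻¹' D
    have hD' : MeasurableSet D' := ASL.measurable_mul_right _ hD
    have h1 : toY ⁻¹' (rightTranslate h ⁻¹' B) ∩ D = (fun g => g * h) ⁻¹' (D' ∩ toY ⁻¹' B) := by
      ext g
      simp only [D', Set.mem_inter_iff, Set.mem_preimage, rightTranslate_toY, mul_inv_cancel_right]
      exact and_comm
    rw [h1, (hη.mul_right h).measure_preimage (hD'.inter hE).nullMeasurableSet,
      Set.inter_comm (toY ⁻¹' B)]
    have hEi : ∀ γ : Lam, ∀ g, (γ : ASL) * g ∈ toY ⁻¹' B ↔ g ∈ toY ⁻¹' B := by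
      intro γ g
      rw [Set.mem_preimage, Set.mem_preimage, ← toY_eq_iff.2 ⟨γ, rfl⟩]
    refine le_antisymm (hη.measure_inter_le hD' hD hE (fun g γ δ h1 h2 => ?_) hDc hEi)
      (hη.measure_inter_le hD hD' hE hDu (fun g => ?_) hEi)
    · simp only [D', Set.mem_preimage, mul_assoc] at h1 h2
      exact hDu _ γ δ h1 h2
    · obtain ⟨γ, hγ⟩ := hDc (g * h⁻¹)
      exact ⟨γ, by simpa only [D', Set.mem_preimage, mul_assoc] using hγ⟩

/-! ### A Haar measure from Lebesgue measure on a cone of matrices. -/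

/-- The space of real `2 × 2` matrices, described by their rows. -/
abbrev Mat : Type := Fin 2 → Plane

/-- The determinant of the matrix with the given rows. -/
def matDet (X : Mat) : ℝ := X 0 0 * X 1 1 - X 0 1 * X 1 0

/-- The cone over `SL(2,ℝ)`, up to height one. -/
def cone : Set Mat := {X | 0 < matDet X ∧ matDet X ≤ 1}

@[fun_prop]
theorem measurable_matDet : Measurable matDet := by
  unfold matDet
  fun_prop

theorem measurableSet_cone : MeasurableSet cone :=
  (measurableSet_lt measurable_const measurable_matDet).inter
    (measurableSet_le measurable_matDet measurable_const)

open Classical in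
/-- The radial projection of the matrices of positive determinant to `SL(2,ℝ)`. -/
def toSL (X : Mat) : SL(2, ℝ) :=
  if h : 0 < matDet X then ⟨Matrix.of fun i j => X i j / √(matDet X), by
    have h1 : √(matDet X) * √(matDet X) = matDet X := Real.mul_self_sqrt h.le
    have h2 : √(matDet X) ≠ 0 := (Real.sqrt_pos.2 h).ne'
    rw [Matrix.det_fin_two]
    simp only [Matrix.of_apply]
    rw [div_mul_div_comm, div_mul_div_comm, h1, ← sub_div]
    exact div_self h.ne'⟩
  else 1

theorem toSL_apply {X : Mat} (h : 0 < matDet X) (i j : Fin 2) :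
    toSL X i j = X i j / √(matDet X) :=
  congrArg (fun A : SL(2, ℝ) => A i j) (dif_pos h)

theorem measurable_toSL_apply (i j : Fin 2) : Measurable fun X : Mat => toSL X i j := by
  classical
  have h : (fun X : Mat => toSL X i j) = fun X =>
      if 0 < matDet X then X i j / √(matDet X) else (1 : SL(2, ℝ)) i j := by
    ext X
    split_ifs with hX
    · exact toSL_apply hX i j
    · exact congrArg (fun A : SL(2, ℝ) => A i j) (dif_neg hX)
  rw [h]
  refine Measurable.ite (measurableSet_lt measurable_const measurable_matDet) ?_ measurable_const
  fun_prop

/-- Left multiplication of matrices, in terms of the rows. -/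
def mulLeftMat (A : SL(2, ℝ)) (X : Mat) : Mat := fun i j => A i 0 * X 0 j + A i 1 * X 1 j

/-- Right multiplication of matrices, in terms of the rows. -/
def mulRightMat (A : SL(2, ℝ)) (X : Mat) : Mat :=
  fun i => X i ᵥ* (A : Matrix (Fin 2) (Fin 2) ℝ)

theorem matDet_mulLeftMat (A : SL(2, ℝ)) (X : Mat) : matDet (mulLeftMat A X) = matDet X := by
  have := det_eq_one A
  simp only [matDet, mulLeftMat]
  linear_combination (X 0 0 * X 1 1 - X 0 1 * X 1 0) * this

theorem matDet_mulRightMat (A : SL(2, ℝ)) (X : Mat) : matDet (mulRightMat A X) = matDet X := by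
  have := det_eq_one A
  simp only [matDet, mulRightMat, vecMul_apply_two]
  linear_combination (X 0 0 * X 1 1 - X 0 1 * X 1 0) * this

theorem SL_ext {A B : SL(2, ℝ)} (h : ∀ i j, A i j = B i j) : A = B :=
  Matrix.SpecialLinearGroup.ext A B h

theorem SL_mul_apply (A B : SL(2, ℝ)) (i j : Fin 2) :
    (A * B) i j = A i 0 * B 0 j + A i 1 * B 1 j := by
  rw [Matrix.SpecialLinearGroup.coe_mul, Matrix.mul_apply, Fin.sum_univ_two]

theorem toSL_mulLeftMat (A : SL(2, ℝ)) {X : Mat} (h : 0 < matDet X) :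
    toSL (mulLeftMat A X) = A * toSL X := by
  refine SL_ext fun i j => ?_
  rw [toSL_apply (by rwa [matDet_mulLeftMat]), SL_mul_apply, toSL_apply h, toSL_apply h,
    matDet_mulLeftMat, mulLeftMat]
  ring

theorem toSL_mulRightMat (A : SL(2, ℝ)) {X : Mat} (h : 0 < matDet X) :
    toSL (mulRightMat A X) = toSL X * A := by
  refine SL_ext fun i j => ?_
  rw [toSL_apply (by rwa [matDet_mulRightMat]), SL_mul_apply, toSL_apply h, toSL_apply h,
    matDet_mulRightMat, mulRightMat, vecMul_apply_two]
  ring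

theorem measurePreserving_mulRightMat (A : SL(2, ℝ)) : MeasurePreserving (mulRightMat A) :=
  volume_preserving_pi fun _ => measurePreserving_vecMul A

/-- Transposition of matrices. -/
def transposeMat : Mat →ₗ[ℝ] Mat where
  toFun X i j := X j i
  map_add' _ _ := rfl
  map_smul' _ _ := rfl

/-- An involution has determinant `±1`. -/
theorem measurePreserving_transposeMat : MeasurePreserving transposeMat := by
  have hdet : LinearMap.det transposeMat * LinearMap.det transposeMat = 1 := by
    rw [← LinearMap.det_comp]
    exact LinearMap.det_id
  have hne : LinearMap.det transposeMat ≠ 0 := left_ne_zero_of_mul_eq_one hdet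
  have habs : |(LinearMap.det transposeMat)⁻¹| = 1 := by
    rcases mul_self_eq_one_iff.1 hdet with h | h <;> simp [h]
  refine ⟨transposeMat.continuous_of_finiteDimensional.measurable, ?_⟩
  rw [Measure.map_linearMap_addHaar_eq_smul_addHaar _ hne, habs]
  simp

/-- Left multiplication is right multiplication by the transpose, conjugated by transposition; right
multiplication acts row by row. -/
theorem measurePreserving_mulLeftMat (A : SL(2, ℝ)) : MeasurePreserving (mulLeftMat A) := by
  have h := measurePreserving_transposeMat.comp
    ((measurePreserving_mulRightMat A.transpose).comp measurePreserving_transposeMat)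
  have e : mulLeftMat A = transposeMat ∘ mulRightMat A.transpose ∘ transposeMat := by
    ext X i j
    simp only [Function.comp_apply, transposeMat, LinearMap.coe_mk, AddHom.coe_mk, mulRightMat,
      vecMul_apply_two, mulLeftMat]
    simp [Matrix.SpecialLinearGroup.transpose, mul_comm]
  rw [e]
  exact h

/-- The cone measure on pairs of a matrix and a translation. -/
def coneMeasure : Measure (Mat × Plane) := (volume.restrict cone).prod volume

/-- The projection of pairs of a matrix and a translation to `ASL(2,ℝ)`. -/
def toASL (p : Mat × Plane) : ASL := ⟨toSL p.1, p.2⟩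

/-- A Haar measure on `ASL(2,ℝ)`. -/
def haarASL : Measure ASL := coneMeasure.map toASL

theorem measurable_toASL : Measurable toASL :=
  ASL.measurable_of_coords (fun i j => (measurable_toSL_apply i j).comp measurable_fst)
    fun i => (measurable_pi_apply i).comp measurable_snd

theorem ae_coneMeasure : ∀ᵐ p ∂coneMeasure, 0 < matDet p.1 := by
  have h : ∀ᵐ X ∂(volume.restrict cone), 0 < matDet X :=
    (ae_restrict_mem measurableSet_cone).mono fun X hX => hX.1
  exact Measure.quasiMeasurePreserving_fst.ae h

theorem measurePreserving_restrict_cone {f : Mat → Mat} (hf : MeasurePreserving f)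
    (hd : ∀ X, matDet (f X) = matDet X) :
    MeasurePreserving f (volume.restrict cone) (volume.restrict cone) := by
  have h := hf.restrict_preimage measurableSet_cone
  have e : f ⁻¹' cone = cone := by
    ext X
    simp [cone, hd]
  rwa [e] at h

/-- Invariance is checked on the cone. The identity is needed only for positive determinant, so the
default value of `toSL` does not matter. -/
theorem measurePreserving_haarASL {φ : ASL → ASL} (hφ : Measurable φ)
    {ψ : Mat × Plane → Mat × Plane}
    (hψ : MeasurePreserving ψ coneMeasure coneMeasure)
    (h : ∀ p : Mat × Plane, 0 < matDet p.1 → φ (toASL p) = toASL (ψ p)) :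
    MeasurePreserving φ haarASL haarASL := by
  refine ⟨hφ, ?_⟩
  rw [haarASL, Measure.map_map hφ measurable_toASL]
  have e : φ ∘ toASL =ᵐ[coneMeasure] toASL ∘ ψ := ae_coneMeasure.mono fun p hp => h p hp
  rw [Measure.map_congr e, ← Measure.map_map measurable_toASL hψ.measurable, hψ.map_eq]

theorem measurePreserving_mul_right_haarASL (h : ASL) :
    MeasurePreserving (fun g => g * h) haarASL haarASL := by
  refine measurePreserving_haarASL (ASL.measurable_mul_right h)
    ((measurePreserving_restrict_cone (measurePreserving_mulRightMat h.lin)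
      (matDet_mulRightMat h.lin)).prod (measurePreserving_act h)) fun p hp => ?_
  refine ASL.ext ?_ rfl
  exact (toSL_mulRightMat h.lin hp).symm

/-- The new translation part depends on the matrix, so this is a skew product: for each fixed matrix
it is a translation of the plane. -/
theorem measurePreserving_mul_left_haarASL (γ : ASL) :
    MeasurePreserving (fun g => γ * g) haarASL haarASL := by
  let k : Mat → Plane → Plane := fun X ξ => γ.trans ᵥ* (toSL X : Matrix (Fin 2) (Fin 2) ℝ) + ξ
  have hk : Measurable (Function.uncurry k) := by
    refine measurable_pi_lambda _ fun i => ?_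
    have h1 : ∀ j, Measurable fun p : Mat × Plane => toSL p.1 j i := fun j =>
      (measurable_toSL_apply j i).comp measurable_fst
    have h2 : Measurable fun p : Mat × Plane => p.2 i := by fun_prop
    simp only [Function.uncurry, k, Pi.add_apply, vecMul_apply_two]
    exact (((h1 0).const_mul _).add ((h1 1).const_mul _)).add h2
  refine measurePreserving_haarASL (ASL.measurable_mul_left γ)
    ((measurePreserving_restrict_cone (measurePreserving_mulLeftMat γ.lin)
      (matDet_mulLeftMat γ.lin)).skew_product hk
      (Filter.Eventually.of_forall fun X => (measurePreserving_add_left _ _).map_eq)) fun p hp => ?_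
  refine ASL.ext ?_ rfl
  exact (toSL_mulLeftMat γ.lin hp).symm

theorem isBiinvariant_haarASL : IsBiinvariant haarASL :=
  ⟨fun γ _ => measurePreserving_mul_left_haarASL γ, measurePreserving_mul_right_haarASL⟩

theorem haarASL_ne_zero : haarASL ≠ 0 := by
  intro h
  have h1 : volume cone ≠ 0 := by
    have hc : Continuous matDet := by
      unfold matDet
      fun_prop
    have ho : IsOpen {X : Mat | 0 < matDet X ∧ matDet X < 1} :=
      (isOpen_lt continuous_const hc).inter (isOpen_lt hc continuous_const)
    have hne : {X : Mat | 0 < matDet X ∧ matDet X < 1}.Nonempty :=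
      ⟨![![1, 0], ![0, 1 / 2]], by norm_num [matDet]⟩
    exact fun h0 => (ho.measure_pos volume hne).ne'
      (measure_mono_null (t := cone) (fun X hX => ⟨hX.1, hX.2.le⟩) h0)
  have h2 : haarASL Set.univ = 0 := by simp [h]
  rw [haarASL, Measure.map_apply measurable_toASL MeasurableSet.univ, Set.preimage_univ,
    coneMeasure, ← Set.univ_prod_univ, Measure.prod_prod, Measure.restrict_apply_univ,
    mul_eq_zero] at h2
  rcases h2 with h2 | h2
  · exact h1 h2
  · simp at h2

/-! ### Reduction theory and finite covolume. -/

/-- The rows of `X` form a reduced basis: the second row is not longer than the first one, and the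
projection of the first row to the second one is short. -/
def IsReducedBasis (X : Mat) : Prop :=
  X 1 0 ^ 2 + X 1 1 ^ 2 ≤ X 0 0 ^ 2 + X 0 1 ^ 2 ∧
    |2 * (X 0 0 * X 1 0 + X 0 1 * X 1 1)| ≤ X 1 0 ^ 2 + X 1 1 ^ 2

theorem measurableSet_isReduced : MeasurableSet {X : Mat | IsReducedBasis X} := by
  have h1 : MeasurableSet {X : Mat | X 1 0 ^ 2 + X 1 1 ^ 2 ≤ X 0 0 ^ 2 + X 0 1 ^ 2} :=
    measurableSet_le (by fun_prop) (by fun_prop)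
  have h2 : MeasurableSet {X : Mat | |2 * (X 0 0 * X 1 0 + X 0 1 * X 1 1)| ≤
      X 1 0 ^ 2 + X 1 1 ^ 2} :=
    measurableSet_le (by fun_prop) (by fun_prop)
  exact h1.inter h2

theorem isReduced_smul {X : Mat} {c : ℝ} (hc : 0 < c) (h : IsReducedBasis fun i j => X i j / c) :
    IsReducedBasis X := by
  obtain ⟨h1, h2⟩ := h
  constructor
  · simp only [div_pow, ← add_div] at h1
    exact (div_le_div_iff_of_pos_right (by positivity)).1 h1
  · have e : 2 * (X 0 0 / c * (X 1 0 / c) + X 0 1 / c * (X 1 1 / c)) =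
        2 * (X 0 0 * X 1 0 + X 0 1 * X 1 1) / c ^ 2 := by
      field_simp
    rw [e, abs_div, abs_of_pos (by positivity : 0 < c ^ 2)] at h2
    simp only [div_pow, ← add_div] at h2
    exact (div_le_div_iff_of_pos_right (by positivity)).1 h2

/-- Reduction theory: every basis of a lattice is equivalent to a reduced one. -/
theorem exists_isReduced (A : SL(2, ℝ)) :
    ∃ M : SL(2, ℤ), IsReducedBasis fun i j => ((M : SL(2, ℝ)) * A) i j := by
  obtain ⟨M, hM1, hM2⟩ := ModularGroup.exists_smul_mem_fd (A • UpperHalfPlane.I)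
  refine ⟨M, ?_⟩
  let B : SL(2, ℝ) := (M : SL(2, ℝ)) * A
  have hB : M • A • UpperHalfPlane.I = B • UpperHalfPlane.I := by
    rw [mul_smul]
    rfl
  rw [hB] at hM1 hM2
  have hdet := det_eq_one B
  -- For `w = B • I`, `|w|²` is the ratio of the squared lengths of the first and second rows, and
  -- `w.re` is their inner product over the squared length of the second. So the conditions of the
  -- fundamental domain are the reduction inequalities.
  have hz := UpperHalfPlane.coe_specialLinearGroup_apply B UpperHalfPlane.I
  set w : ℂ := ((B • UpperHalfPlane.I : UpperHalfPlane) : ℂ) with hw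
  have hI : ((UpperHalfPlane.I : UpperHalfPlane) : ℂ) = Complex.I := rfl
  simp only [Algebra.algebraMap_self, RingHom.id_apply, hI] at hz
  have hden : ((B 1 0 : ℂ) * Complex.I + B 1 1) ≠ 0 := by
    intro h0
    have hre := congrArg Complex.re h0
    have him := congrArg Complex.im h0
    simp at hre him
    rw [hre, him] at hdet
    norm_num at hdet
  rw [eq_div_iff hden] at hz
  have hre := congrArg Complex.re hz
  have him := congrArg Complex.im hz
  simp at hre him
  have hn : 1 ≤ w.re * w.re + w.im * w.im := by
    rw [← Complex.normSq_apply]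
    exact hM1
  have hr : |w.re| ≤ 1 / 2 := hM2
  have hN : 0 ≤ B 1 0 ^ 2 + B 1 1 ^ 2 := by positivity
  constructor
  · change B 1 0 ^ 2 + B 1 1 ^ 2 ≤ B 0 0 ^ 2 + B 0 1 ^ 2
    have e : B 0 0 ^ 2 + B 0 1 ^ 2 =
        (w.re * w.re + w.im * w.im) * (B 1 0 ^ 2 + B 1 1 ^ 2) := by
      rw [← hre, ← him]
      ring
    rw [e]
    exact le_mul_of_one_le_left hN hn
  · change |2 * (B 0 0 * B 1 0 + B 0 1 * B 1 1)| ≤ B 1 0 ^ 2 + B 1 1 ^ 2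
    have e : 2 * (B 0 0 * B 1 0 + B 0 1 * B 1 1) = 2 * w.re * (B 1 0 ^ 2 + B 1 1 ^ 2) := by
      rw [← hre, ← him]
      ring
    rw [e, abs_mul, abs_of_nonneg hN, abs_mul, abs_two]
    exact mul_le_of_le_one_left hN (by linarith)

/-- The second row of a reduced basis of covolume at most one is short. -/
theorem norm_le_two_of_isReduced {X : Mat} (h : IsReducedBasis X) (hX : X ∈ cone) : ‖X 1‖ ≤ 2 := by
  obtain ⟨h1, h2⟩ := h
  obtain ⟨hd0, hd1⟩ := hX
  have hlag : (X 0 0 * X 1 0 + X 0 1 * X 1 1) ^ 2 + matDet X ^ 2 =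
      (X 0 0 ^ 2 + X 0 1 ^ 2) * (X 1 0 ^ 2 + X 1 1 ^ 2) := by
    unfold matDet
    ring
  set N := X 1 0 ^ 2 + X 1 1 ^ 2 with hN
  have hN0 : 0 ≤ N := by positivity
  have h3 := abs_le.1 h2
  have h4 : (2 * (X 0 0 * X 1 0 + X 0 1 * X 1 1)) ^ 2 ≤ N ^ 2 := sq_le_sq' h3.1 h3.2
  have h5 : N * N ≤ (X 0 0 ^ 2 + X 0 1 ^ 2) * N := mul_le_mul_of_nonneg_right h1 hN0
  have h6 : matDet X ^ 2 ≤ 1 := by nlinarith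
  -- Lagrange's identity gives `N² ≤ N²/4 + 1`; the bound 4 is not sharp.
  have h7 : N ≤ 4 := by nlinarith
  rw [norm_plane_le (by norm_num)]
  constructor
  · exact abs_le_of_sq_le_sq (by nlinarith [sq_nonneg (X 1 1)]) (by norm_num)
  · exact abs_le_of_sq_le_sq (by nlinarith [sq_nonneg (X 1 0)]) (by norm_num)

theorem volume_closedBall_plane {r : ℝ} (hr : 0 ≤ r) :
    volume (Metric.closedBall (0 : Plane) r) = ENNReal.ofReal ((2 * r) ^ 2) := by
  rw [Real.volume_pi_closedBall _ hr, Fintype.card_fin]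

/-- An area-preserving linear map sends `a` to its projection coefficient along `b` and minus the
determinant of `a`, `b`. Both are at most one in absolute value, so the section fits into a copy of
`[-1, 1]²`. -/
theorem volume_reduced_section_le (b : Plane) :
    volume {a : Plane | IsReducedBasis ![a, b] ∧ ![a, b] ∈ cone} ≤ 4 := by
  by_cases hb : b = 0
  · have : {a : Plane | IsReducedBasis ![a, b] ∧ ![a, b] ∈ cone} = ∅ := by
      ext a
      simp [hb, cone, matDet]
    simp [this]
  let N := b 0 ^ 2 + b 1 ^ 2
  have hN : 0 < N := by
    by_contra! h
    have h0 : b 0 ^ 2 + b 1 ^ 2 ≤ 0 := h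
    have e0 : b 0 = 0 := by nlinarith [sq_nonneg (b 0), sq_nonneg (b 1)]
    have e1 : b 1 = 0 := by nlinarith [sq_nonneg (b 0), sq_nonneg (b 1)]
    exact hb (funext (Fin.forall_fin_two.2 ⟨e0, e1⟩))
  let M : SL(2, ℝ) := ⟨!![b 0 / N, -b 1; b 1 / N, b 0], by
    rw [Matrix.det_fin_two_of]
    have : b 0 / N * b 0 - -b 1 * (b 1 / N) = (b 0 ^ 2 + b 1 ^ 2) / N := by ring
    rw [this]
    exact div_self hN.ne'⟩
  have hsub : {a : Plane | IsReducedBasis ![a, b] ∧ ![a, b] ∈ cone} ⊆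
      (fun x : Plane => x ᵥ* (M : Matrix (Fin 2) (Fin 2) ℝ)) ⁻¹' Metric.closedBall 0 1 := by
    rintro a ⟨⟨-, h1⟩, hd0, hd1⟩
    simp only [matDet, Matrix.cons_val] at hd0 hd1 h1
    rw [Set.mem_preimage, mem_closedBall_zero_iff, norm_plane_le zero_le_one, vecMul_apply_two,
      vecMul_apply_two]
    constructor
    · change |a 0 * (b 0 / N) + a 1 * (b 1 / N)| ≤ 1
      have e : a 0 * (b 0 / N) + a 1 * (b 1 / N) = (a 0 * b 0 + a 1 * b 1) / N := by ring
      rw [e, abs_div, abs_of_pos hN, div_le_one hN]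
      rw [abs_mul, abs_two] at h1
      have h1' : 2 * |a 0 * b 0 + a 1 * b 1| ≤ N := h1
      linarith [abs_nonneg (a 0 * b 0 + a 1 * b 1)]
    · change |a 0 * -b 1 + a 1 * b 0| ≤ 1
      rw [abs_le]
      constructor <;> linarith
  refine (measure_mono hsub).trans ?_
  rw [(measurePreserving_vecMul M).measure_preimage
    Metric.isClosed_closedBall.measurableSet.nullMeasurableSet, volume_closedBall_plane zero_le_one]
  norm_num

/-- Fubini over the second row, which stays in `[-2, 2]²`, with sections of area at most 4. -/
theorem volume_reduced_ne_top : volume ({X : Mat | IsReducedBasis X} ∩ cone) ≠ ∞ := by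
  have hm : MeasurableSet ({X : Mat | IsReducedBasis X} ∩ cone) :=
    measurableSet_isReduced.inter measurableSet_cone
  have e := (volume_preserving_finTwoArrow Plane).symm
  rw [← e.measure_preimage hm.nullMeasurableSet, Measure.volume_eq_prod,
    Measure.prod_apply_symm (e.measurable hm)]
  have hle : ∀ b : Plane, volume ((fun a : Plane => (a, b)) ⁻¹'
      (MeasurableEquiv.finTwoArrow.symm ⁻¹' ({X : Mat | IsReducedBasis X} ∩ cone))) ≤
        4 * square 2 b := by
    intro b
    have hs : (fun a : Plane => (a, b)) ⁻¹'
      (MeasurableEquiv.finTwoArrow.symm ⁻¹' ({X : Mat | IsReducedBasis X} ∩ cone)) =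
        {a : Plane | IsReducedBasis ![a, b] ∧ ![a, b] ∈ cone} := rfl
    rw [hs]
    by_cases hb : ‖b‖ ≤ 2
    · rw [square_of_norm_le hb, mul_one]
      exact volume_reduced_section_le b
    · have : {a : Plane | IsReducedBasis ![a, b] ∧ ![a, b] ∈ cone} = ∅ := by
        rw [Set.eq_empty_iff_forall_notMem]
        rintro a ⟨h1, h2⟩
        exact hb (norm_le_two_of_isReduced h1 h2)
      simp [this]
  refine ne_top_of_le_ne_top ?_ (lintegral_mono hle)
  rw [lintegral_const_mul _ (measurable_square 2), lintegral_square (by norm_num)]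
  exact ENNReal.mul_ne_top (by simp) ENNReal.ofReal_ne_top

/-- The coordinates of the translation part of `g` in the basis given by its linear part. -/
def transCoord (g : ASL) : Plane :=
  ![g.trans 0 * g.lin 1 1 - g.trans 1 * g.lin 1 0, g.trans 1 * g.lin 0 0 - g.trans 0 * g.lin 0 1]

/-- The elements of `ASL(2,ℝ)` that are reduced with respect to `SL(2,ℤ) ⋉ ℤ²`. -/
def reducedSet : Set ASL :=
  {g | (IsReducedBasis fun i j => g.lin i j) ∧
    transCoord g ∈ Set.univ.pi fun _ : Fin 2 => Set.Ico 0 1}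

theorem measurable_transCoord : Measurable transCoord := by
  refine measurable_pi_lambda _ fun i => ?_
  fin_cases i
  · simp only [transCoord, Fin.zero_eta, Matrix.cons_val]
    fun_prop
  · simp only [transCoord, Fin.mk_one, Matrix.cons_val]
    fun_prop

theorem measurableSet_reducedSet : MeasurableSet reducedSet :=
  (measurableSet_isReduced.preimage (measurable_pi_lambda _ fun i => measurable_pi_lambda _ fun j =>
    ASL.measurable_lin_apply i j)).inter
      (measurable_transCoord (MeasurableSet.univ_pi fun _ => measurableSet_Ico))

theorem transCoord_intASL_mul (k : Fin 2 → ℤ) (g : ASL) :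
    transCoord (intASL 1 k * g) = intVec k + transCoord g := by
  have hd := det_eq_one g.lin
  have hl : (intASL 1 k * g).lin = g.lin := by
    rw [ASL.mul_lin]
    simp [intASL]
  have ht : ∀ i, (intASL 1 k * g).trans i =
      k 0 * g.lin 0 i + k 1 * g.lin 1 i + g.trans i := fun i => by
    rw [ASL.mul_trans, ASL.act_apply]
    rfl
  ext i
  fin_cases i
  · simp only [transCoord, hl, ht, Fin.zero_eta, Matrix.cons_val, Pi.add_apply, intVec]
    linear_combination (k 0 : ℝ) * hd
  · simp only [transCoord, hl, ht, Fin.mk_one, Matrix.cons_val, Pi.add_apply, intVec]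
    linear_combination (k 1 : ℝ) * hd

theorem exists_intASL_mul_mem_reducedSet (g : ASL) :
    ∃ (M : SL(2, ℤ)) (n : Fin 2 → ℤ), intASL M n * g ∈ reducedSet := by
  obtain ⟨M, hM⟩ := exists_isReduced g.lin
  -- The floors are taken after reducing the linear part, since that step changes the coordinates of
  -- the translation.
  let k : Fin 2 → ℤ := fun i => -⌊transCoord (intASL M 0 * g) i⌋
  refine ⟨1 * M, k ᵥ* (M : Matrix (Fin 2) (Fin 2) ℤ) + 0, ?_⟩
  rw [← intASL_mul, mul_assoc]
  constructor
  · have e : (intASL 1 k * (intASL M 0 * g)).lin = (M : SL(2, ℝ)) * g.lin := by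
      rw [ASL.mul_lin, ASL.mul_lin]
      simp [intASL]
    rw [e]
    exact hM
  · rw [transCoord_intASL_mul]
    intro i _
    have h1 := Int.fract_nonneg (transCoord (intASL M 0 * g) i)
    have h2 := Int.fract_lt_one (transCoord (intASL M 0 * g) i)
    unfold Int.fract at h1 h2
    simp only [Pi.add_apply, intVec, k, Int.cast_neg, Set.mem_Ico]
    constructor <;> linarith

/-- For fixed linear part `A` the coordinates are `ξ A⁻¹`, an area-preserving function of `ξ`. -/
theorem volume_transCoord_section (A : SL(2, ℝ)) :
    volume {ξ : Plane | transCoord ⟨A, ξ⟩ ∈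
      Set.univ.pi fun _ : Fin 2 => Set.Ico (0 : ℝ) 1} = 1 := by
  have e : ∀ ξ : Plane, transCoord ⟨A, ξ⟩ =
      ξ ᵥ* ((A⁻¹ : SL(2, ℝ)) : Matrix (Fin 2) (Fin 2) ℝ) := by
    intro ξ
    ext i
    rw [vecMul_apply_two]
    rw [Matrix.SpecialLinearGroup.coe_inv, Matrix.adjugate_fin_two]
    fin_cases i
    · simp [transCoord]
      ring
    · simp [transCoord]
      ring
  simp only [e]
  have h := (measurePreserving_vecMul A⁻¹).measure_preimage
    (MeasurableSet.univ_pi fun _ : Fin 2 =>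
      measurableSet_Ico (a := (0 : ℝ)) (b := 1)).nullMeasurableSet
  refine h.trans ?_
  rw [volume_pi, Measure.pi_pi]
  simp

theorem haarASL_reducedSet_ne_top : haarASL reducedSet ≠ ∞ := by
  have hm : MeasurableSet (toASL ⁻¹' reducedSet) := measurable_toASL measurableSet_reducedSet
  rw [haarASL, Measure.map_apply measurable_toASL measurableSet_reducedSet, coneMeasure,
    Measure.prod_apply hm]
  refine ne_top_of_le_ne_top volume_reduced_ne_top ?_
  rw [← Measure.restrict_apply measurableSet_isReduced,
    ← lintegral_indicator_one measurableSet_isReduced]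
  refine lintegral_mono_ae ?_
  filter_upwards [ae_restrict_mem measurableSet_cone] with X hX
  by_cases h : IsReducedBasis X
  · rw [Set.indicator_of_mem (s := {X : Mat | IsReducedBasis X}) h, Pi.one_apply,
      ← volume_transCoord_section (toSL X)]
    exact measure_mono fun ξ hξ => hξ.2
  · rw [Set.indicator_of_notMem (s := {X : Mat | IsReducedBasis X}) h, nonpos_iff_eq_zero]
    convert measure_empty (μ := (volume : Measure Plane))
    rw [Set.eq_empty_iff_forall_notMem]
    rintro ξ ⟨hξ, -⟩
    refine h (isReduced_smul (Real.sqrt_pos.2 hX.1) ?_)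
    convert hξ using 3 with i j
    exact (toSL_apply hX.1 i j).symm

instance : Gamma204.FiniteIndex := by
  have : CongruenceSubgroup.Gamma 4 ≤ Gamma204 := by
    intro M hM
    rw [CongruenceSubgroup.Gamma_mem] at hM
    left
    ext i j
    fin_cases i <;> fin_cases j <;> simp [hM]
  exact Subgroup.finiteIndex_of_le this

/-- There is an invariant probability measure on `Y`. -/
theorem exists_isInvariantProbability : ∃ μ : Measure YSpace, IsInvariantProbability μ := by
  -- Reduction uses all of `SL(2,ℤ) ⋉ ℤ²`; finitely many coset representatives of `Γ_{2,0}(4)` pass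
  -- to `Λ`.
  let S : Set ASL := ⋃ t : SL(2, ℤ) ⧸ Gamma204, (fun g => intASL t.out 0 * g) ⁻¹' reducedSet
  have hpre : ∀ t : SL(2, ℤ) ⧸ Gamma204,
      MeasurableSet ((fun g => intASL t.out 0 * g) ⁻¹' reducedSet) := fun t =>
    ASL.measurable_mul_left _ measurableSet_reducedSet
  have : Finite (SL(2, ℤ) ⧸ Gamma204) := Subgroup.finite_quotient_of_finiteIndex
  have := Fintype.ofFinite (SL(2, ℤ) ⧸ Gamma204)
  refine isBiinvariant_haarASL.exists_isInvariantProbability haarASL_ne_zero (S := S)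
    (MeasurableSet.iUnion hpre) (fun g => ?_) ?_
  · obtain ⟨M, n, h⟩ := exists_intASL_mul_mem_reducedSet g
    obtain ⟨δ, hδ⟩ := QuotientGroup.mk_out_eq_mul Gamma204 M
    refine ⟨⟨intASL (δ⁻¹ : Gamma204) n, _, (δ⁻¹).2, n, rfl⟩, Set.mem_iUnion.2 ⟨(M : _ ⧸ _), ?_⟩⟩
    rw [Set.mem_preimage, ← mul_assoc, intASL_mul, hδ]
    simpa using h
  · refine ne_top_of_le_ne_top ?_ (measure_iUnion_le _)
    rw [tsum_fintype]
    refine ENNReal.sum_ne_top.2 fun t _ => ?_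
    rw [(measurePreserving_mul_left_haarASL _).measure_preimage
      measurableSet_reducedSet.nullMeasurableSet]
    exact haarASL_reducedSet_ne_top

/-! ### The points of `Θ` and their pairs. -/

/-- The two shifts `0` and `(1/2, -1/4)`. -/
def shift (b : Bool) : Plane := if b then shiftVec else 0

/-- The two signs. -/
def signMap (b : Bool) (x : Plane) : Plane := if b then -x else x

/-- The right and the left half plane. -/
def halfPlane (b : Bool) : Set Plane := if b then leftHalfPlane else rightHalfPlane

/-- The points of `ℤ² g` and of `-(ℤ² + (1/2, -1/4)) g`. -/
def candidate (i : Bool × (Fin 2 → ℤ)) (g : ASL) : Plane :=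
  signMap i.1 (ASL.act (intVec i.2 + shift i.1) g)

theorem shift_eq (b : Bool) : shift b = 0 ∨ shift b = shiftVec := by
  cases b
  · exact Or.inl rfl
  · exact Or.inr rfl

theorem mem_thetaSet_iff {g : ASL} {x : Plane} :
    x ∈ thetaSet g ↔ ∃ i, candidate i g = x ∧ x ∈ halfPlane i.1 := by
  simp only [thetaSet, affineLattice, Set.mem_union, Set.mem_inter_iff, Set.mem_range,
    Set.mem_image, exists_exists_eq_and, Prod.exists, Bool.exists_bool, candidate, signMap, shift,
    halfPlane, if_true, exists_and_right, Bool.false_eq_true, if_false]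

theorem measurable_signMap (b : Bool) : Measurable (signMap b) := by
  cases b
  · exact measurable_id
  · exact measurable_neg

theorem measurePreserving_signMap (b : Bool) : MeasurePreserving (signMap b) := by
  cases b
  · exact MeasurePreserving.id _
  · exact Measure.measurePreserving_neg _

theorem measurable_candidate (i : Bool × (Fin 2 → ℤ)) : Measurable (candidate i) :=
  (measurable_signMap _).comp (ASL.measurable_act _)

theorem measurableSet_halfPlane (b : Bool) : MeasurableSet (halfPlane b) := by
  cases b
  · exact measurableSet_le measurable_const (measurable_pi_apply 0)
  · exact measurableSet_le (measurable_pi_apply 0) measurable_const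

/-- The first coordinate is integral for one shift and half-integral for the other. Thus distinct
labels are the same as distinct points before the sign change, as the pair formula requires. -/
theorem intVec_add_shift_eq_iff (i j : Bool × (Fin 2 → ℤ)) :
    intVec i.2 + shift i.1 = intVec j.2 + shift j.1 ↔ i = j := by
  refine ⟨fun h => ?_, fun h => by rw [h]⟩
  have hne : ∀ m n : Fin 2 → ℤ, intVec m + 0 ≠ intVec n + shiftVec := by
    intro m n h
    have h1 := congrFun h 0
    simp only [intVec, shiftVec, Pi.add_apply, Pi.zero_apply, Matrix.cons_val] at h1
    have h2 : ((2 * (m 0 - n 0) : ℤ) : ℝ) = (1 : ℤ) := by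
      push_cast
      linarith
    have h3 : 2 * (m 0 - n 0) = 1 := by exact_mod_cast h2
    omega
  obtain ⟨b, m⟩ := i
  obtain ⟨c, n⟩ := j
  cases b <;> cases c
  · exact congrArg _ (intVec_injective (add_right_cancel h))
  · exact absurd h (hne m n)
  · exact absurd h.symm (hne n m)
  · exact congrArg _ (intVec_injective (add_right_cancel h))

/-- The event that two different candidates both belong to their half planes. -/
def pairEvent (p : (Bool × (Fin 2 → ℤ)) × (Bool × (Fin 2 → ℤ))) : Set ASL :=
  {g | p.1 ≠ p.2 ∧ candidate p.1 g ∈ halfPlane p.1.1 ∧ candidate p.2 g ∈ halfPlane p.2.1}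

theorem measurableSet_pairEvent (p : (Bool × (Fin 2 → ℤ)) × (Bool × (Fin 2 → ℤ))) :
    MeasurableSet (pairEvent p) :=
  (MeasurableSet.const _).inter ((measurable_candidate _ (measurableSet_halfPlane _)).inter
    (measurable_candidate _ (measurableSet_halfPlane _)))

/-- A pair of candidates. -/
def candidatePair (p : (Bool × (Fin 2 → ℤ)) × (Bool × (Fin 2 → ℤ))) (g : ASL) : Plane × Plane :=
  (candidate p.1 g, candidate p.2 g)

theorem measurable_candidatePair (p : (Bool × (Fin 2 → ℤ)) × (Bool × (Fin 2 → ℤ))) :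
    Measurable (candidatePair p) :=
  (measurable_candidate _).prodMk (measurable_candidate _)

theorem volume_axis : volume {x : Plane | x 0 = 0} = 0 := by
  have hm : MeasurableSet {x : Plane | x 0 = 0} :=
    measurableSet_eq_fun (measurable_pi_apply 0) measurable_const
  rw [← lintegral_indicator_one hm, lintegral_plane_swap _ (measurable_one.indicator hm)]
  have h : ∀ y : ℝ, ∫⁻ x : ℝ, Set.indicator {x : Plane | x 0 = 0} 1 ![x, y] = 0 := by
    intro y
    have e : ∀ x : ℝ, Set.indicator {x : Plane | x 0 = 0} (1 : Plane → ℝ≥0∞) ![x, y] =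
        Set.indicator {0} 1 x := fun x => rfl
    simp only [e]
    rw [lintegral_indicator_one (measurableSet_singleton _)]
    simp
  simp [h]

/-- Almost surely no candidate lies on both half planes, hence the candidates are distinct. -/
theorem IsInvariantLift.ae_candidate_ne {P : Measure ASL} (hP : IsInvariantLift P) :
    ∀ᵐ g ∂P, ∀ p, g ∈ pairEvent p → candidate p.1 g ≠ candidate p.2 g := by
  have hm : MeasurableSet {x : Plane | x 0 = 0} :=
    measurableSet_eq_fun (measurable_pi_apply 0) measurable_const
  have haxis : ∀ᵐ g ∂P, ∀ i, candidate i g 0 ≠ 0 := by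
    rw [ae_all_iff]
    intro i
    -- With the constant weight 1 the formula says that the points have Lebesgue intensity, and the
    -- axis is a null set.
    have h := hP.lintegral_mul_tsum_act (shift_eq i.1) (H := fun _ => 1)
      ⟨measurable_const, fun _ _ _ => rfl, fun _ _ => rfl⟩
      (u := Set.indicator {x : Plane | x 0 = 0} 1) (measurable_one.indicator hm)
    rw [lintegral_indicator_one hm, volume_axis, mul_zero] at h
    simp only [one_mul] at h
    rw [lintegral_eq_zero_iff (f := fun g => ∑' m,
      Set.indicator {x : Plane | x 0 = 0} 1 (ASL.act (intVec m + shift i.1) g))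
      (Measurable.tsum fun m => (measurable_one.indicator hm).comp (ASL.measurable_act _))] at h
    filter_upwards [h] with g hg h0
    have h1 := ENNReal.tsum_eq_zero.1 hg i.2
    rw [Set.indicator_apply_eq_zero] at h1
    refine one_ne_zero (h1 ?_)
    unfold candidate signMap at h0
    split_ifs at h0 with hb
    · exact neg_eq_zero.1 h0
    · exact h0
  filter_upwards [haxis] with g hg
  rintro ⟨⟨b, m⟩, ⟨c, n⟩⟩ ⟨hne, h1, h2⟩ heq
  have hne0 := hg (b, m)
  have hinj : ∀ b m n, candidate (b, m) g = candidate (b, n) g → m = n := by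
    intro b m n h
    have h' : ASL.act (intVec m + shift b) g = ASL.act (intVec n + shift b) g := by
      cases b
      · exact h
      · exact neg_injective h
    exact intVec_injective (add_right_cancel (ASL.act_injective g h'))
  simp only at heq h1 h2
  -- With equal signs, coinciding candidates have equal labels; with opposite signs, the common
  -- point lies in both half planes and hence on the axis.
  cases b <;> cases c
  · exact hne (congrArg _ (hinj _ _ _ heq))
  · rw [← heq] at h2
    exact hne0 (le_antisymm h2 h1)
  · rw [← heq] at h2
    exact hne0 (le_antisymm h1 h2)
  · exact hne (congrArg _ (hinj _ _ _ heq))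

/-- Off the null set where a first coordinate vanishes, each pair lies in exactly one of the four
products of half planes. -/
theorem lintegral_indicator_halfPlane {F : Plane × Plane → ℝ≥0∞} (hF : Measurable F) :
    ∑' b, ∑' c, ∫⁻ q, (halfPlane b ×ˢ halfPlane c).indicator F q = ∫⁻ q, F q := by
  have hm : ∀ b c, MeasurableSet (halfPlane b ×ˢ halfPlane c) := fun b c =>
    (measurableSet_halfPlane b).prod (measurableSet_halfPlane c)
  have hae : ∀ᵐ x : Plane, x 0 ≠ 0 := by
    rw [ae_iff]
    simpa using volume_axis
  have hae2 : ∀ᵐ q : Plane × Plane, q.1 0 ≠ 0 ∧ q.2 0 ≠ 0 := by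
    rw [Measure.volume_eq_prod]
    exact (Measure.quasiMeasurePreserving_fst.ae hae).and
      (Measure.quasiMeasurePreserving_snd.ae hae)
  have h1 : ∀ b, ∑' c, ∫⁻ q, (halfPlane b ×ˢ halfPlane c).indicator F q =
      ∫⁻ q, ∑' c, (halfPlane b ×ˢ halfPlane c).indicator F q := fun b =>
    (lintegral_tsum fun c => (hF.indicator (hm b c)).aemeasurable).symm
  simp only [h1]
  rw [← lintegral_tsum fun b =>
    (Measurable.tsum fun c => hF.indicator (hm b c)).aemeasurable]
  refine lintegral_congr_ae ?_
  filter_upwards [hae2] with q hq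
  have hf : ∀ x : Plane, x ∈ halfPlane false ↔ 0 ≤ x 0 := fun x => Iff.rfl
  have ht : ∀ x : Plane, x ∈ halfPlane true ↔ x 0 ≤ 0 := fun x => Iff.rfl
  simp only [tsum_bool, Set.indicator, Set.mem_prod, hf, ht]
  rcases lt_or_gt_of_ne hq.1 with h1 | h1 <;> rcases lt_or_gt_of_ne hq.2 with h2 | h2 <;>
    simp [h1.le, h2.le, h1.not_ge, h2.not_ge]

/-- The sum over the pairs of distinct points of `Θ`, in terms of the candidates. -/
theorem IsInvariantLift.lintegral_tsum_pairEvent {P : Measure ASL} (hP : IsInvariantLift P)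
    {F : Plane × Plane → ℝ≥0∞} (hF : Measurable F) :
    ∫⁻ g, ∑' p, (pairEvent p).indicator (fun g => F (candidatePair p g)) g ∂P = ∫⁻ q, F q := by
  -- Signs and half planes are moved into the test function, so that the pair formula applies to the
  -- unsigned points.
  let G : Bool → Bool → Plane × Plane → ℝ≥0∞ := fun b c q =>
    (halfPlane b ×ˢ halfPlane c).indicator F (signMap b q.1, signMap c q.2)
  have hFm : ∀ b c, Measurable ((halfPlane b ×ˢ halfPlane c).indicator F) := fun b c =>
    hF.indicator ((measurableSet_halfPlane b).prod (measurableSet_halfPlane c))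
  have hmap : ∀ b c, MeasurePreserving (Prod.map (signMap b) (signMap c))
      (volume : Measure (Plane × Plane)) volume := fun b c =>
    (measurePreserving_signMap b).prod (measurePreserving_signMap c)
  have hG : ∀ b c, Measurable (G b c) := fun b c => (hFm b c).comp (hmap b c).measurable
  have hpt : ∀ (b c : Bool) (m n : Fin 2 → ℤ) (g : ASL),
      (pairEvent ((b, m), (c, n))).indicator (fun g => F (candidatePair ((b, m), (c, n)) g)) g =
      {p : (Fin 2 → ℤ) × (Fin 2 → ℤ) | intVec p.1 + shift b ≠ intVec p.2 + shift c}.indicator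
        (fun p => G b c (ASL.act (intVec p.1 + shift b) g, ASL.act (intVec p.2 + shift c) g))
        (m, n) := by
    intro b c m n g
    by_cases h1 : g ∈ pairEvent ((b, m), (c, n))
    · have h2 : (m, n) ∈ {p : (Fin 2 → ℤ) × (Fin 2 → ℤ) |
          intVec p.1 + shift b ≠ intVec p.2 + shift c} := fun h =>
        h1.1 ((intVec_add_shift_eq_iff (b, m) (c, n)).1 h)
      rw [Set.indicator_of_mem h1, Set.indicator_of_mem h2]
      exact (Set.indicator_of_mem (s := halfPlane b ×ˢ halfPlane c) h1.2 F).symm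
    · rw [Set.indicator_of_notMem h1]
      refine (Set.indicator_apply_eq_zero.2 fun h2 => ?_).symm
      exact Set.indicator_of_notMem (s := halfPlane b ×ˢ halfPlane c) (fun h3 => h1
        ⟨fun h => h2 ((intVec_add_shift_eq_iff (b, m) (c, n)).2 h), h3⟩) F
  have hsum : ∀ g, ∑' p, (pairEvent p).indicator (fun g => F (candidatePair p g)) g =
      ∑' b, ∑' c, ∑' p : {p : (Fin 2 → ℤ) × (Fin 2 → ℤ) //
        intVec p.1 + shift b ≠ intVec p.2 + shift c},
        G b c (ASL.act (intVec p.1.1 + shift b) g, ASL.act (intVec p.1.2 + shift c) g) := by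
    intro g
    rw [ENNReal.tsum_prod', ENNReal.tsum_prod']
    congr 1 with b
    simp only [ENNReal.tsum_prod', hpt]
    rw [ENNReal.tsum_comm]
    congr 1 with c
    rw [← ENNReal.tsum_prod' (f := {p : (Fin 2 → ℤ) × (Fin 2 → ℤ) | intVec p.1 + shift b ≠
      intVec p.2 + shift c}.indicator (fun p => G b c (ASL.act (intVec p.1 + shift b) g,
        ASL.act (intVec p.2 + shift c) g)))]
    exact (tsum_subtype _ _).symm
  have hm : ∀ b c, Measurable fun g => ∑' p : {p : (Fin 2 → ℤ) × (Fin 2 → ℤ) //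
        intVec p.1 + shift b ≠ intVec p.2 + shift c},
        G b c (ASL.act (intVec p.1.1 + shift b) g, ASL.act (intVec p.1.2 + shift c) g) :=
    fun b c => Measurable.tsum fun p => (hG b c).comp
      ((ASL.measurable_act _).prodMk (ASL.measurable_act _))
  simp only [hsum]
  rw [lintegral_tsum fun b => (Measurable.tsum fun c => hm b c).aemeasurable,
    ← lintegral_indicator_halfPlane hF]
  congr 1 with b
  rw [lintegral_tsum fun c => (hm b c).aemeasurable]
  congr 1 with c
  rw [hP.lintegral_tsum_pairs (shift_eq b) (shift_eq c) (hG b c)]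
  exact (hmap b c).lintegral_comp (hFm b c)

/-- The intensity measure of the pairs of distinct points of `Θ` is Lebesgue measure. -/
theorem IsInvariantLift.sum_map_candidatePair {P : Measure ASL} (hP : IsInvariantLift P) :
    Measure.sum (fun p => (P.restrict (pairEvent p)).map (candidatePair p)) = volume := by
  refine Measure.ext_of_lintegral _ fun F hF => ?_
  rw [← hP.lintegral_tsum_pairEvent hF, lintegral_sum_measure, lintegral_tsum]
  · congr 1 with p
    rw [lintegral_map hF (measurable_candidatePair p),
      lintegral_indicator (measurableSet_pairEvent p)]
  · exact fun p => ((hF.comp (measurable_candidatePair p)).indicator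
      (measurableSet_pairEvent p)).aemeasurable

/-- The pairs of distinct points of `Θ` correspond to the pairs of candidates. -/
theorem exists_equiv_offDiag {g : ASL}
    (hg : ∀ p, g ∈ pairEvent p → candidate p.1 g ≠ candidate p.2 g) :
    ∃ e : {p | g ∈ pairEvent p} ≃ (thetaSet g).offDiag, ∀ p, (e p : Plane × Plane) =
      candidatePair p g := by
  let φ : {p | g ∈ pairEvent p} → (thetaSet g).offDiag := fun p => ⟨candidatePair p g,
    mem_thetaSet_iff.2 ⟨p.1.1, rfl, p.2.2.1⟩, mem_thetaSet_iff.2 ⟨p.1.2, rfl, p.2.2.2⟩, hg p p.2⟩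
  have hinj : ∀ i j, candidate i g ∈ halfPlane i.1 → candidate j g ∈ halfPlane j.1 →
      candidate i g = candidate j g → i = j := by
    intro i j hi hj h
    by_contra hne
    exact hg (i, j) ⟨hne, hi, hj⟩ h
  refine ⟨Equiv.ofBijective φ ⟨?_, ?_⟩, fun p => rfl⟩
  · rintro ⟨⟨i, j⟩, hp⟩ ⟨⟨i', j'⟩, hp'⟩ h
    have h' : candidatePair (i, j) g = candidatePair (i', j') g := congrArg Subtype.val h
    have h1 := hinj i i' hp.2.1 hp'.2.1 (congrArg Prod.fst h')
    have h2 := hinj j j' hp.2.2 hp'.2.2 (congrArg Prod.snd h')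
    subst h1 h2
    rfl
  · rintro ⟨⟨x, y⟩, hx, hy, hne⟩
    obtain ⟨i, hi, hi'⟩ := mem_thetaSet_iff.1 hx
    obtain ⟨j, hj, hj'⟩ := mem_thetaSet_iff.1 hy
    simp only at hi hi' hj hj' hne
    subst hi hj
    exact ⟨⟨(i, j), fun h => hne (congrArg (candidate · g) h), hi', hj'⟩, rfl⟩

/-! ### From nonnegative functions to integrable ones. -/

variable {𝕜 : Type*} [RCLike 𝕜]

theorem summable_and_pairSum_eq {g : ASL}
    (hg : ∀ p, g ∈ pairEvent p → candidate p.1 g ≠ candidate p.2 g) (f : Plane × Plane → 𝕜) :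
    ((Summable fun p : (thetaSet g).offDiag => f p) ↔
      Summable fun p => (pairEvent p).indicator (fun g => f (candidatePair p g)) g) ∧
    pairSum f (thetaSet g) = ∑' p, (pairEvent p).indicator (fun g => f (candidatePair p g)) g := by
  obtain ⟨e, he⟩ := exists_equiv_offDiag hg
  have hind : (fun p => (pairEvent p).indicator (fun g => f (candidatePair p g)) g) =
      Set.indicator {p | g ∈ pairEvent p} fun p => f (candidatePair p g) := by
    ext p
    simp only [Set.indicator, Set.mem_ofPred_eq]
  have hcomp : (fun p : (thetaSet g).offDiag => f p) ∘ e =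
      (fun p => f (candidatePair p g)) ∘ ((↑) : {p | g ∈ pairEvent p} → _) := by
    ext p
    simp only [Function.comp_apply, he]
  constructor
  · rw [← e.summable_iff, hcomp, hind]
    exact summable_subtype_iff_indicator
  · rw [hind, ← tsum_subtype, pairSum, ← e.tsum_eq]
    exact tsum_congr fun p => by rw [he]

/-- The nonnegative formula for `‖f‖` makes the terms absolutely summable in mean, which gives
almost sure summability, integrability and the exchange of sum and expectation. -/
theorem IsInvariantLift.pairSum_thetaSet {P : Measure ASL} (hP : IsInvariantLift P)
    {f : Plane × Plane → 𝕜} (hf : Integrable f) :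
    (∀ᵐ g ∂P, Summable fun p : (thetaSet g).offDiag => f p) ∧
    Integrable (fun g => pairSum f (thetaSet g)) P ∧
    ∫ g, pairSum f (thetaSet g) ∂P = ∫ x, f x := by
  let T : (Bool × (Fin 2 → ℤ)) × (Bool × (Fin 2 → ℤ)) → ASL → 𝕜 := fun p =>
    (pairEvent p).indicator fun g => f (candidatePair p g)
  have hf' := hf
  -- As `f` is only almost everywhere measurable, the formula is used as an equality of measures:
  -- integrability then passes to each pushforward.
  rw [← hP.sum_map_candidatePair] at hf'
  have hfp : ∀ p, Integrable f ((P.restrict (pairEvent p)).map (candidatePair p)) := fun p =>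
    hf'.mono_measure (Measure.le_sum _ _)
  have hfc : ∀ p, Integrable (fun g => f (candidatePair p g)) (P.restrict (pairEvent p)) := fun p =>
    (hfp p).comp_measurable (measurable_candidatePair p)
  have hT : ∀ p, Integrable (T p) P := fun p =>
    (integrable_indicator_iff (measurableSet_pairEvent p)).2 (hfc p)
  have hTnorm : ∑' p, ∫⁻ g, ‖T p g‖ₑ ∂P ≠ ∞ := by
    have e : ∀ p, ∫⁻ g, ‖T p g‖ₑ ∂P =
        ∫⁻ q, ‖f q‖ₑ ∂((P.restrict (pairEvent p)).map (candidatePair p)) := by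
      intro p
      rw [lintegral_map' (hfp p).1.enorm (measurable_candidatePair p).aemeasurable,
        ← lintegral_indicator (measurableSet_pairEvent p)]
      congr 1 with g
      exact enorm_indicator_eq_indicator_enorm _ _
    simp only [e]
    rw [← lintegral_sum_measure]
    exact hf'.2.ne
  have hlint : ∫⁻ g, ∑' p, ‖T p g‖ₑ ∂P ≠ ∞ := by
    rwa [lintegral_tsum fun p => (hT p).1.enorm]
  have hgood := hP.ae_candidate_ne
  have hsum : ∀ᵐ g ∂P, Summable fun p => T p g := by
    filter_upwards [ae_lt_top' (AEMeasurable.tsum fun p => (hT p).1.enorm) hlint] with g hg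
    refine Summable.of_nnnorm (ENNReal.tsum_coe_ne_top_iff_summable.1 hg.ne)
  have hTint : Integrable (fun g => ∑' p, T p g) P := by
    refine ⟨(AEMeasurable.tsum fun p => (hT p).1.aemeasurable).aestronglyMeasurable, ?_⟩
    exact lt_of_le_of_lt (lintegral_mono fun g => enorm_tsum_le_tsum_enorm) hlint.lt_top
  have heq : (fun g => pairSum f (thetaSet g)) =ᵐ[P] fun g => ∑' p, T p g :=
    hgood.mono fun g hg => (summable_and_pairSum_eq hg f).2
  refine ⟨?_, hTint.congr heq.symm, ?_⟩
  · filter_upwards [hgood, hsum] with g hg hs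
    exact (summable_and_pairSum_eq hg f).1.2 hs
  · rw [integral_congr_ae heq, integral_tsum (fun p => (hT p).1) hTnorm,
      ← hP.sum_map_candidatePair, integral_sum_measure hf']
    congr 1 with p
    rw [integral_map (measurable_candidatePair p).aemeasurable (hfp p).1,
      ← integral_indicator (measurableSet_pairEvent p)]

end

theorem theorem5 {𝕜 : Type*} [RCLike 𝕜] :
    (∃ μ : Measure YSpace, IsInvariantProbability μ) ∧
    ∀ μ : Measure YSpace, IsInvariantProbability μ →
      ∀ f : Plane × Plane → 𝕜, Integrable f (volume : Measure (Plane × Plane)) →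
        (∀ᵐ y ∂μ, Summable fun p : (Theta y).offDiag => f p) ∧
        Integrable (fun y => pairSum f (Theta y)) μ ∧
        twoPointIntensity μ f = ∫ x : Plane × Plane, f x := by
  refine ⟨exists_isInvariantProbability, fun μ hμ f hf => ?_⟩
  obtain ⟨σ, hσ, hs⟩ := exists_measurable_section
  have hΘ : ∀ y, Theta y = thetaSet (σ y) := by
    intro y
    conv_lhs => rw [← hs y]
    rfl
  obtain ⟨h1, h2, h3⟩ := (hμ.isInvariantLift hσ hs).pairSum_thetaSet hf
  simp only [twoPointIntensity, hΘ]
  refine ⟨(ae_of_ae_map hσ.aemeasurable h1).mono fun y hy => by rwa [hΘ], h2.comp_measurable hσ, ?_⟩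
  rw [← h3, integral_map hσ.aemeasurable h2.1]
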